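/- Let $L$ be the $z$-axis in $\mathbb{R}^3$. Let $v_1,\dots,v_n$ be distinct unit vectors in $\mathbb{R}^3$ with $z$-coordinate $0$ and $\sum_{i=1}^n v_i = 0$, and let $H_i=\{t v_i + s e_3 : t\ge 0,\ s\in\mathbb{R}\}$ be the closed half-plane that contains $v_i$ and has boundary $L$. For $r,l>0$ let $C=\{(x,y,z) : x^2+y^2\le r^2,\ 0\le z\le l\}$ be a closed solid cylinder about $L$. Call $\mathcal{B}= C\cap\bigcup_{i=1}^n H_i$ a book, and call $\mathcal{E}(\mathcal{B})=\partial C\cap\bigcup_{i=1}^n H_i$ its edge set, where $\partial C$ is the boundary surface of $C$. Let $\mathcal{H}^2$ be the two-dimensional Hausdorff measure. Theorem (Books are minimal). For every book $\mathcal{B}$ and every bi-Lipschitz map $f:\mathbb{R}^3\to\mathbb{R}^3$ (that is, for some $K\ge 1$, $K^{-1}|x-y|\le |f(x)-f(y)|\le K|x-y|$ for all $x,y$) such that $f(p)=p$ for all $p\in\mathcal{E}(\mathcal{B})$, $$\mathcal{H}^2(\mathcal{B})\le \mathcal{H}^2(f(\mathcal{B})),$$ and if $\mathcal{H}^2(f(\mathcal{B}))=\mathcal{H}^2(\mathcal{B})$,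 then $f(\mathcal{B})=\mathcal{B}$. -/

import Mathlib

open scoped MeasureTheory

/-- Euclidean three-space. -/
abbrev R3 : Type := EuclideanSpace ℝ (Fin 3)

/-- The vertical unit vector, which spans the `z`-axis `L`. -/
noncomputable def vertical : R3 := EuclideanSpace.single 2 1

/-- A stationary set `V = {v₁, …, vₙ}` of `n` (distinct) horizontal unit vectors in `ℝ³`:
their sum is zero. -/
structure IsStationaryDirections {n : ℕ} (v : Fin n → R3) : Prop where
  norm_eq_one : ∀ i, ‖v i‖ = 1
  horizontal : ∀ i, v i 2 = 0
  injective : Function.Injective v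
  sum_eq_zero : ∑ i, v i = 0

/-- The closed half-plane which contains the horizontal unit vector `u` and whose boundary line is
the `z`-axis. -/
def halfPlane (u : R3) : Set R3 :=
  {p | ∃ t s : ℝ, 0 ≤ t ∧ p = t • u + s • vertical}

/-- The closed solid circular cylinder of radius `r` and height `l` about the `z`-axis. -/
def solidCylinder (r l : ℝ) : Set R3 :=
  {p | p 0 ^ 2 + p 1 ^ 2 ≤ r ^ 2 ∧ 0 ≤ p 2 ∧ p 2 ≤ l}

/-- The part in the cylinder of the union of the half-planes with directions `v i`. -/
def book {n : ℕ} (v : Fin n → R3) (r l : ℝ) : Set R3 :=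
  solidCylinder r l ∩ ⋃ i, halfPlane (v i)

/-- The edge set: the part of the half-planes on the boundary surface of the cylinder. -/
def edgeSet {n : ℕ} (v : Fin n → R3) (r l : ℝ) : Set R3 :=
  frontier (solidCylinder r l) ∩ ⋃ i, halfPlane (v i)

/-- `f` is bi-Lipschitz: for some constants `K`, `K'`, both `|f x - f y| ≤ K |x - y|` and
`|x - y| ≤ K' |f x - f y|` for all `x`, `y`. -/
def IsBilipschitz (f : R3 → R3) : Prop :=
  (∃ K : NNReal, LipschitzWith K f) ∧ ∃ K' : NNReal, AntilipschitzWith K' f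

open MeasureTheory Filter Set Topology

/-! The proof is a calibration argument. Parametrize page `i` by a rectangle and let `F i` be `f`
composed with this parametrization. With `U i` and `W i` the components of `F i` along `v i` and
`vertical`, integrate `dU i ∧ dW i` over the rectangle and add over the pages. By Stokes this sum
depends only on boundary values: the three outer sides are fixed by `f`, and on the spine all `F i`
coincide, so the contributions there cancel because the `v i` add up to zero. The sum is therefore
the area of the undeformed book (`sum_integral_pairJacobian`). Since orthogonal projection to a
plane does not increase area, each integral is at most the area of the image page
(`lintegral_abs_pairJacobian_le`), and the inequality follows.

If equality holds, the calibrating Jacobian of each page dominates the Jacobian of every other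
orthonormal pair almost everywhere. Rotating the pair infinitesimally towards the page normal shows
that the mixed Jacobians vanish (`ae_eq_zero_of_rotation`). As the differential is injective, the
normal component has zero derivative; it is zero on the outer sides, so the image page lies in the
plane of the page.

It remains to confine the image to the book within these planes. The Stokes formula is applied again
with one coordinate replaced by its `excess` over an interval. The boundary contributions still
vanish, while the integrand is nonnegative, and positive almost everywhere that the interval is
left; so it is never left (`mem_of_sum_integral_jacobian_eq_zero`). Hence `f` maps the book into
itself, and equal finite areas together with compactness give equality of the sets. -/

/-! ### Integration by parts for Lipschitz functions -/

theorem lineDeriv_comp_add_const {E : Type*} [NormedAddCommGroup E] [NormedSpace ℝ E]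
    (u : E → ℝ) (c x a : E) :
    lineDeriv ℝ (fun y => u (y + c)) x a = lineDeriv ℝ u (x + c) a := by
  simp only [lineDeriv, add_right_comm]

theorem integrable_lineDeriv_mul_of_hasCompactSupport {E : Type*} [NormedAddCommGroup E]
    [NormedSpace ℝ E] [MeasurableSpace E] [BorelSpace E] [SecondCountableTopology E]
    [LocallyCompactSpace E] (μ : Measure E) [IsFiniteMeasureOnCompacts μ] {u w : E → ℝ}
    {C : NNReal} (hu : LipschitzWith C u) (hw : Continuous w) (hws : HasCompactSupport w) (a : E) :
    Integrable (fun x => lineDeriv ℝ u x a * w x) μ :=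
  (hw.integrable_of_hasCompactSupport hws).bdd_mul
    (aestronglyMeasurable_lineDeriv hu.continuous μ)
    (Eventually.of_forall fun _ => norm_lineDeriv_le_of_lipschitz ℝ hu)

section NullLagrangian

variable {E : Type*} [NormedAddCommGroup E] [NormedSpace ℝ E] [MeasurableSpace E] [BorelSpace E]
  (μ : Measure E)

theorem integrable_lineDeriv_of_hasCompactSupport [SecondCountableTopology E]
    [LocallyCompactSpace E] [IsFiniteMeasureOnCompacts μ] {u : E → ℝ} {C : NNReal}
    (hu : LipschitzWith C u) (hus : HasCompactSupport u) (a : E) :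
    Integrable (fun x => lineDeriv ℝ u x a) μ := by
  have hb : IntegrableOn (fun x => lineDeriv ℝ u x a) (tsupport u) μ :=
    Measure.integrableOn_of_bounded (M := C * ‖a‖) hus.isCompact.measure_lt_top.ne
      (aestronglyMeasurable_lineDeriv hu.continuous μ)
      (Eventually.of_forall fun _ => norm_lineDeriv_le_of_lipschitz ℝ hu)
  rwa [integrableOn_iff_integrable_of_support_subset] at hb
  intro x hx
  by_contra hxu
  apply hx
  have h0 : u =ᶠ[𝓝 x] fun _ => 0 := notMem_tsupport_iff_eventuallyEq.1 hxu
  have : lineDeriv ℝ u x a = lineDeriv ℝ (fun _ => (0 : ℝ)) x a :=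
    Filter.EventuallyEq.lineDeriv_eq h0
  exact this.trans (by simp [lineDeriv])

/-- The `2`-form `du ∧ dw` integrates to zero when `u` and `w` are compactly supported Lipschitz
functions. -/
theorem integral_lineDeriv_mul_lineDeriv_comm [FiniteDimensional ℝ E]
    [μ.IsAddHaarMeasure] {u w : E → ℝ} {C D : NNReal}
    (hu : LipschitzWith C u) (hus : HasCompactSupport u)
    (hw : LipschitzWith D w) (hws : HasCompactSupport w) (a b : E) :
    ∫ x, lineDeriv ℝ u x a * lineDeriv ℝ w x b ∂μ =
      ∫ x, lineDeriv ℝ u x b * lineDeriv ℝ w x a ∂μ := by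
  have h1 := hw.integral_inv_smul_sub_mul_tendsto_integral_lineDeriv_mul (μ := μ)
    (integrable_lineDeriv_of_hasCompactSupport μ hu hus a) b
  have h2 := (hu.integral_inv_smul_sub_mul_tendsto_integral_lineDeriv_mul (μ := μ)
    (integrable_lineDeriv_of_hasCompactSupport μ hw hws a) (-b)).neg
  -- The smooth proof would use mixed second derivatives, which Lipschitz functions lack. The
  -- derivative along `b` is replaced by a difference quotient; for fixed `t`, integration by parts
  -- along `a` and a translation by `t • b` give an exact identity, and only then does `t` tend to
  -- zero.
  have h12 : ∀ t : ℝ, ∫ x, (t⁻¹ • (w (x + t • b) - w x)) * lineDeriv ℝ u x a ∂μ =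
      -∫ x, (t⁻¹ • (u (x + t • -b) - u x)) * lineDeriv ℝ w x a ∂μ := by
    intro t
    have hwt : LipschitzWith D (fun x => w (x + t • b)) := fun x y => by
      simpa using hw (x + t • b) (y + t • b)
    have hwts : HasCompactSupport (fun x => w (x + t • b)) :=
      hws.comp_homeomorph (Homeomorph.addRight (t • b))
    have hut : Continuous (fun x => u (x + t • -b)) := hu.continuous.comp (by fun_prop)
    have huts : HasCompactSupport (fun x => u (x + t • -b)) :=
      hus.comp_homeomorph (Homeomorph.addRight (t • -b))
    have e1 : ∫ x, (t⁻¹ • (w (x + t • b) - w x)) * lineDeriv ℝ u x a ∂μ =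
        t⁻¹ * (∫ x, lineDeriv ℝ u x a * w (x + t • b) ∂μ - ∫ x, lineDeriv ℝ u x a * w x ∂μ) := by
      rw [← integral_sub
        (integrable_lineDeriv_mul_of_hasCompactSupport μ hu hwt.continuous hwts a)
        (integrable_lineDeriv_mul_of_hasCompactSupport μ hu hw.continuous hws a),
        ← integral_const_mul]
      congr 1; ext x; simp only [smul_eq_mul]; ring
    have e2 : ∫ x, (t⁻¹ • (u (x + t • -b) - u x)) * lineDeriv ℝ w x a ∂μ =
        t⁻¹ * (∫ x, lineDeriv ℝ w x a * u (x + t • -b) ∂μ - ∫ x, lineDeriv ℝ w x a * u x ∂μ) := by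
      rw [← integral_sub
        (integrable_lineDeriv_mul_of_hasCompactSupport μ hw hut huts a)
        (integrable_lineDeriv_mul_of_hasCompactSupport μ hw hu.continuous hus a),
        ← integral_const_mul]
      congr 1; ext x; simp only [smul_eq_mul]; ring
    have e3 : ∫ x, lineDeriv ℝ u x a * w (x + t • b) ∂μ =
        -∫ x, lineDeriv ℝ w x a * u (x + t • -b) ∂μ := by
      rw [hu.integral_lineDeriv_mul_eq hwt hwts a, ← integral_neg,
        ← integral_add_right_eq_self _ (t • -b)]
      congr 1; ext x
      rw [lineDeriv_comp_add_const]
      simp [lineDeriv_neg]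
    have e4 : ∫ x, lineDeriv ℝ u x a * w x ∂μ = -∫ x, lineDeriv ℝ w x a * u x ∂μ := by
      rw [hu.integral_lineDeriv_mul_eq hw hws a, ← integral_neg]
      congr 1; ext x; simp [lineDeriv_neg]
    rw [e1, e2, e3, e4]; ring
  have h3 := tendsto_nhds_unique (h1.congr h12) h2
  calc _ = ∫ x, lineDeriv ℝ w x b * lineDeriv ℝ u x a ∂μ := by simp only [mul_comm]
    _ = _ := by rw [h3, ← integral_neg]; congr 1; ext x; simp [lineDeriv_neg]

end NullLagrangian

/-! ### Lipschitz functions and Jacobians on the parameter plane -/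

/-- The parameter plane of the pages. -/
abbrev Plane : Type := EuclideanSpace ℝ (Fin 2)

/-- A function that is Lipschitz with some constant. -/
def IsLipschitz {X Y : Type*} [PseudoEMetricSpace X] [PseudoEMetricSpace Y] (u : X → Y) : Prop :=
  ∃ K : NNReal, LipschitzWith K u

namespace IsLipschitz

variable {X Y Z : Type*} [PseudoEMetricSpace X] [PseudoEMetricSpace Y] [PseudoEMetricSpace Z]

theorem continuous {u : X → Y} (hu : IsLipschitz u) : Continuous u := hu.choose_spec.continuous

theorem comp {g : Y → Z} {u : X → Y} (hg : IsLipschitz g) (hu : IsLipschitz u) :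
    IsLipschitz fun x => g (u x) :=
  ⟨_, hg.choose_spec.comp hu.choose_spec⟩

theorem const (y : Y) : IsLipschitz fun _ : X => y := ⟨0, LipschitzWith.const y⟩

theorem id : IsLipschitz fun x : X => x := ⟨1, LipschitzWith.id⟩

theorem add {E : Type*} [SeminormedAddCommGroup E] {u w : X → E} (hu : IsLipschitz u)
    (hw : IsLipschitz w) : IsLipschitz fun x => u x + w x :=
  ⟨_, hu.choose_spec.add hw.choose_spec⟩

theorem sub {E : Type*} [SeminormedAddCommGroup E] {u w : X → E} (hu : IsLipschitz u)
    (hw : IsLipschitz w) : IsLipschitz fun x => u x - w x :=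
  ⟨_, hu.choose_spec.sub hw.choose_spec⟩

theorem clm {E F : Type*} [NormedAddCommGroup E] [NormedSpace ℝ E] [NormedAddCommGroup F]
    [NormedSpace ℝ F] (L : E →L[ℝ] F) : IsLipschitz L := ⟨_, L.lipschitz⟩

theorem max {u w : X → ℝ} (hu : IsLipschitz u) (hw : IsLipschitz w) :
    IsLipschitz fun x => max (u x) (w x) :=
  ⟨_, hu.choose_spec.max hw.choose_spec⟩

theorem min {u w : X → ℝ} (hu : IsLipschitz u) (hw : IsLipschitz w) :
    IsLipschitz fun x => min (u x) (w x) :=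
  ⟨_, hu.choose_spec.min hw.choose_spec⟩

theorem ae_differentiableAt {E F : Type*} [NormedAddCommGroup E] [NormedSpace ℝ E]
    [FiniteDimensional ℝ E] [MeasurableSpace E] [BorelSpace E] [NormedAddCommGroup F]
    [NormedSpace ℝ F] [FiniteDimensional ℝ F] {μ : Measure E} [μ.IsAddHaarMeasure] {u : E → F}
    (hu : IsLipschitz u) : ∀ᵐ x ∂μ, DifferentiableAt ℝ u x :=
  hu.choose_spec.ae_differentiableAt

/-- The product of a Lipschitz function with a bounded Lipschitz function of bounded support is
Lipschitz. -/
theorem mul_of_bounded_support {E : Type*} [NormedAddCommGroup E] {χ u : E → ℝ} {M : ℝ}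
    (hχ : IsLipschitz χ) (hu : IsLipschitz u) (hM : ∀ x, M ≤ ‖x‖ → χ x = 0) :
    IsLipschitz fun x => χ x * u x := by
  obtain ⟨A, hA⟩ := hχ
  obtain ⟨K, hK⟩ := hu
  obtain ⟨R, hR⟩ : ∃ R : NNReal, M ≤ R := ⟨M.toNNReal, Real.le_coe_toNNReal M⟩
  have hub : ∀ x, ‖x‖ ≤ R → ‖u x‖ ≤ ‖u 0‖ + K * R := fun x hx => by
    have h1 : ‖u x‖ ≤ ‖u 0‖ + ‖u x - u 0‖ := norm_le_insert' _ _
    have h2 := hK.norm_sub_le x 0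
    rw [sub_zero] at h2
    nlinarith [K.2, mul_le_mul_of_nonneg_left hx K.2]
  have hχb : ∀ x, ‖χ x‖ ≤ ‖χ 0‖ + A * R := fun x => by
    rcases le_total ‖x‖ R with hx | hx
    · have h1 : ‖χ x‖ ≤ ‖χ 0‖ + ‖χ x - χ 0‖ := norm_le_insert' _ _
      have h2 := hA.norm_sub_le x 0
      rw [sub_zero] at h2
      nlinarith [A.2, mul_le_mul_of_nonneg_left hx A.2]
    · rw [hM x (hR.trans hx), norm_zero]
      positivity
  let B : NNReal := (‖u 0‖₊ + K * R) * A + (‖χ 0‖₊ + A * R) * K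
  have key : ∀ x y, ‖x‖ ≤ R → ‖χ x * u x - χ y * u y‖ ≤ B * ‖x - y‖ := fun x y hx => by
    have e : χ x * u x - χ y * u y = u x * (χ x - χ y) + χ y * (u x - u y) := by ring
    rw [e]
    refine (norm_add_le _ _).trans ?_
    rw [norm_mul, norm_mul]
    have h1 := mul_le_mul (hub x hx) (hA.norm_sub_le x y) (norm_nonneg _) (by positivity)
    have h2 := mul_le_mul (hχb y) (hK.norm_sub_le x y) (norm_nonneg _) (by positivity)
    simp only [B, NNReal.coe_add, NNReal.coe_mul, coe_nnnorm]
    linarith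
  refine ⟨B, LipschitzWith.of_dist_le_mul fun x y => ?_⟩
  rw [dist_eq_norm, dist_eq_norm]
  rcases le_total ‖x‖ R with hx | hx
  · exact key x y hx
  rcases le_total ‖y‖ R with hy | hy
  · rw [norm_sub_rev, norm_sub_rev x y]
    exact key y x hy
  · rw [hM x (hR.trans hx), hM y (hR.trans hy)]
    simp only [zero_mul, sub_zero, norm_zero]
    positivity

end IsLipschitz

/-- The Jacobian determinant of the pair `(u, w)`. -/
noncomputable def jacobian (u w : Plane → ℝ) (p : Plane) : ℝ :=
  fderiv ℝ u p (EuclideanSpace.single 0 1) * fderiv ℝ w p (EuclideanSpace.single 1 1) -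
    fderiv ℝ u p (EuclideanSpace.single 1 1) * fderiv ℝ w p (EuclideanSpace.single 0 1)

theorem measurable_jacobian (u w : Plane → ℝ) : Measurable (jacobian u w) :=
  ((measurable_fderiv_apply_const ℝ u _).mul (measurable_fderiv_apply_const ℝ w _)).sub
    ((measurable_fderiv_apply_const ℝ u _).mul (measurable_fderiv_apply_const ℝ w _))

theorem exists_abs_jacobian_le {u w : Plane → ℝ} (hu : IsLipschitz u) (hw : IsLipschitz w) :
    ∃ M, ∀ p, |jacobian u w p| ≤ M := by
  obtain ⟨K, hK⟩ := hu
  obtain ⟨K', hK'⟩ := hw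
  have h1 : ∀ p (j : Fin 2), |fderiv ℝ u p (EuclideanSpace.single j 1)| ≤ K := fun p j => by
    simpa using ((fderiv ℝ u p).le_opNorm (EuclideanSpace.single j 1)).trans
      (mul_le_mul_of_nonneg_right (norm_fderiv_le_of_lipschitz ℝ hK) (norm_nonneg _))
  have h2 : ∀ p (j : Fin 2), |fderiv ℝ w p (EuclideanSpace.single j 1)| ≤ K' := fun p j => by
    simpa using ((fderiv ℝ w p).le_opNorm (EuclideanSpace.single j 1)).trans
      (mul_le_mul_of_nonneg_right (norm_fderiv_le_of_lipschitz ℝ hK') (norm_nonneg _))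
  refine ⟨K * K' + K * K', fun p => (abs_sub _ _).trans ?_⟩
  rw [abs_mul, abs_mul]
  gcongr <;> first | apply h1 | apply h2

theorem integrableOn_jacobian {u w : Plane → ℝ} (hu : IsLipschitz u) (hw : IsLipschitz w)
    {s : Set Plane} (hs : volume s ≠ ⊤) : IntegrableOn (jacobian u w) s := by
  obtain ⟨M, hM⟩ := exists_abs_jacobian_le hu hw
  exact Measure.integrableOn_of_bounded (M := M) hs (measurable_jacobian u w).aestronglyMeasurable
    (Eventually.of_forall hM)

theorem jacobian_congr {u u' w w' : Plane → ℝ} {p : Plane} (hu : u =ᶠ[𝓝 p] u')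
    (hw : w =ᶠ[𝓝 p] w') : jacobian u w p = jacobian u' w' p := by
  rw [jacobian, jacobian, hu.fderiv_eq, hw.fderiv_eq]

theorem jacobian_eq_zero_of_fderiv_left {u w : Plane → ℝ} {p : Plane} (h : fderiv ℝ u p = 0) :
    jacobian u w p = 0 := by
  simp [jacobian, h]

theorem jacobian_eq_zero_of_fderiv_right {u w : Plane → ℝ} {p : Plane} (h : fderiv ℝ w p = 0) :
    jacobian u w p = 0 := by
  simp [jacobian, h]

theorem jacobian_sum_left {ι : Type*} (s : Finset ι) {u : ι → Plane → ℝ} {w : Plane → ℝ}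
    {p : Plane} (hu : ∀ i ∈ s, DifferentiableAt ℝ (u i) p) :
    jacobian (fun q => ∑ i ∈ s, u i q) w p = ∑ i ∈ s, jacobian (u i) w p := by
  simp only [jacobian, fderiv_fun_sum hu, sum_apply, Finset.sum_mul,
    Finset.sum_sub_distrib]

theorem integral_jacobian_eq_zero {u w : Plane → ℝ} (hu : IsLipschitz u)
    (hus : HasCompactSupport u) (hw : IsLipschitz w) (hws : HasCompactSupport w) :
    ∫ p, jacobian u w p = 0 := by
  obtain ⟨K, hK⟩ := hu
  obtain ⟨K', hK'⟩ := hw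
  have hi : ∀ a b : Plane, Integrable fun p => lineDeriv ℝ u p a * lineDeriv ℝ w p b :=
    fun a b => (integrable_lineDeriv_of_hasCompactSupport volume hK' hws b).bdd_mul
      (aestronglyMeasurable_lineDeriv hK.continuous _)
      (Eventually.of_forall fun _ => norm_lineDeriv_le_of_lipschitz ℝ hK)
  have h := integral_lineDeriv_mul_lineDeriv_comm volume hK hus hK' hws
    (EuclideanSpace.single 0 1) (EuclideanSpace.single 1 1)
  rw [← sub_eq_zero, ← integral_sub (hi _ _) (hi _ _)] at h
  rw [← h]
  refine integral_congr_ae ?_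
  filter_upwards [hK.ae_differentiableAt, hK'.ae_differentiableAt] with p h1 h2
  simp only [jacobian, h1.lineDeriv_eq_fderiv, h2.lineDeriv_eq_fderiv]

/-! ### The parameter rectangle and the Stokes formula for a book -/

/-- The open parameter rectangle of a page. -/
def openRect (r l : ℝ) : Set Plane := {p | 0 < p 0 ∧ p 0 < r ∧ 0 < p 1 ∧ p 1 < l}

/-- The closed parameter rectangle of a page. -/
def closedRect (r l : ℝ) : Set Plane := {p | 0 ≤ p 0 ∧ p 0 ≤ r ∧ 0 ≤ p 1 ∧ p 1 ≤ l}

/-- The open region beyond the three sides of the rectangle that do not lie on the spine. -/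
def outerRegion (r l : ℝ) : Set Plane := {p | r < p 0 ∨ p 1 < 0 ∨ l < p 1}

theorem isOpen_openRect (r l : ℝ) : IsOpen (openRect r l) := by
  simp only [openRect, ofPred_and]
  exact ((isOpen_lt (by fun_prop) (by fun_prop)).inter ((isOpen_lt (by fun_prop) (by fun_prop)).inter
    ((isOpen_lt (by fun_prop) (by fun_prop)).inter (isOpen_lt (by fun_prop) (by fun_prop)))))

theorem isOpen_outerRegion (r l : ℝ) : IsOpen (outerRegion r l) := by
  simp only [outerRegion, ofPred_or]
  exact (isOpen_lt (by fun_prop) (by fun_prop)).union ((isOpen_lt (by fun_prop) (by fun_prop)).union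
    (isOpen_lt (by fun_prop) (by fun_prop)))

theorem norm_le_abs_add_abs (p : Plane) : ‖p‖ ≤ |p 0| + |p 1| := by
  rw [EuclideanSpace.norm_eq, Real.sqrt_le_left (by positivity)]
  simp only [Fin.sum_univ_two, Real.norm_eq_abs]
  nlinarith [abs_nonneg (p 0), abs_nonneg (p 1)]

theorem norm_le_of_mem_closedRect {r l : ℝ} {p : Plane} (hp : p ∈ closedRect r l) :
    ‖p‖ ≤ r + l := by
  obtain ⟨h0, h1, h2, h3⟩ := hp
  have := norm_le_abs_add_abs p
  rw [abs_of_nonneg h0, abs_of_nonneg h2] at this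
  linarith

theorem openRect_subset_closedRect (r l : ℝ) : openRect r l ⊆ closedRect r l :=
  fun _ hp => ⟨hp.1.le, hp.2.1.le, hp.2.2.1.le, hp.2.2.2.le⟩

theorem isCompact_closedRect (r l : ℝ) : IsCompact (closedRect r l) := by
  refine Metric.isCompact_of_isClosed_isBounded ?_ ?_
  · simp only [closedRect, ofPred_and]
    exact ((isClosed_le (by fun_prop) (by fun_prop)).inter ((isClosed_le (by fun_prop)
      (by fun_prop)).inter ((isClosed_le (by fun_prop) (by fun_prop)).inter
      (isClosed_le (by fun_prop) (by fun_prop)))))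
  · exact (Metric.isBounded_closedBall (x := (0 : Plane)) (r := r + l)).subset fun p hp => by
      simpa using norm_le_of_mem_closedRect hp

theorem volume_closedRect_ne_top (r l : ℝ) : volume (closedRect r l) ≠ ⊤ :=
  (isCompact_closedRect r l).measure_lt_top.ne

theorem volume_openRect_ne_top (r l : ℝ) : volume (openRect r l) ≠ ⊤ :=
  measure_ne_top_of_subset (openRect_subset_closedRect r l) (volume_closedRect_ne_top r l)

theorem ae_coord_ne (j : Fin 2) (c : ℝ) : ∀ᵐ p : Plane, p j ≠ c := by
  have h : ∀ᵐ x : Fin 2 → ℝ, x j ≠ c := by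
    have := Measure.pi_hyperplane (fun _ : Fin 2 => (volume : Measure ℝ)) j c
    rw [ae_iff]
    simpa [volume_pi] using this
  exact (EuclideanSpace.volume_preserving_symm_measurableEquiv_toLp
    (Fin 2)).quasiMeasurePreserving.ae h

/-- Only four coordinate lines are left out, and they are null. Derivatives can thus be computed on
open sets, on each of which the extended functions have a single description; no boundary integral
ever appears. -/
theorem ae_mem_openRect_or (r l : ℝ) :
    ∀ᵐ p : Plane, p ∈ openRect r l ∨ p 0 < 0 ∨ p ∈ outerRegion r l := by
  filter_upwards [ae_coord_ne 0 0, ae_coord_ne 0 r, ae_coord_ne 1 0, ae_coord_ne 1 l]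
    with p h1 h2 h3 h4
  simp only [openRect, outerRegion, mem_ofPred_eq]
  by_contra! h
  obtain ⟨h5, h6, h7, h8, h9⟩ := h
  have := h5 (lt_of_le_of_ne h6 (Ne.symm h1)) (lt_of_le_of_ne h7 h2)
    (lt_of_le_of_ne h8 (Ne.symm h3))
  exact h4 (le_antisymm h9 this)

theorem volume_openRect (r l : ℝ) : volume (openRect r l) = volume (closedRect r l) := by
  refine le_antisymm (measure_mono (openRect_subset_closedRect r l)) (measure_mono_ae ?_)
  filter_upwards [ae_mem_openRect_or r l] with p hp hpc
  obtain ⟨h0, h1, h2, h3⟩ : p ∈ closedRect r l := hpc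
  rcases hp with hp | hp | hp
  · exact hp
  · linarith
  · simp only [outerRegion, mem_ofPred_eq] at hp
    grind

/-- A Lipschitz cutoff function of the plane. -/
noncomputable def cutoff (M : ℝ) (p : Plane) : ℝ := max 0 (min 1 (M - ‖p‖))

theorem isLipschitz_cutoff (M : ℝ) : IsLipschitz (cutoff M) :=
  (IsLipschitz.const 0).max ((IsLipschitz.const 1).min
    ((IsLipschitz.const M).sub ⟨1, lipschitzWith_one_norm⟩))

theorem cutoff_eq_zero {M : ℝ} {p : Plane} (h : M ≤ ‖p‖) : cutoff M p = 0 :=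
  max_eq_left ((min_le_right _ _).trans (by linarith))

theorem cutoff_eq_one {M : ℝ} {p : Plane} (h : ‖p‖ ≤ M - 1) : cutoff M p = 1 := by
  rw [cutoff, min_eq_left (by linarith), max_eq_right zero_le_one]

theorem hasCompactSupport_cutoff_mul (M : ℝ) (u : Plane → ℝ) :
    HasCompactSupport fun p => cutoff M p * u p :=
  HasCompactSupport.intro (isCompact_closedBall (0 : Plane) M) fun p hp => by
    rw [cutoff_eq_zero (by simpa using (not_le.1 (by simpa using hp)).le), zero_mul]

theorem isOpen_leftHalf : IsOpen {p : Plane | p 0 < 0} :=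
  isOpen_lt (by fun_prop) (by fun_prop)

/-- A Stokes formula for a book: the integrals of `dUᵢ ∧ dWᵢ` over the pages add up to zero if the
boundary contributions of the sides vanish and those at the spine cancel. The functions are extended
beyond the spine to the left half plane. -/
theorem sum_integral_jacobian_eq_zero {n : ℕ} {r l : ℝ} {U W : Fin n → Plane → ℝ} {w : Plane → ℝ}
    (hU : ∀ i, IsLipschitz (U i)) (hW : ∀ i, IsLipschitz (W i))
    (hUl : ∀ p : Plane, p 0 < 0 → ∑ i, U i p = 0)
    (hWl : ∀ i, ∀ p : Plane, p 0 < 0 → W i p = w p)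
    (hout : ∀ i, (∀ p ∈ outerRegion r l, U i p = 0) ∨ ∀ p ∈ outerRegion r l, W i p = 0) :
    ∑ i, ∫ p in openRect r l, jacobian (U i) (W i) p = 0 := by
  -- The closed rectangle lies in the ball of radius `r + l`, and this cutoff equals one up to
  -- radius `r + l + 1`, so it does not affect derivatives in the rectangle.
  set χ := cutoff (r + l + 2)
  have hχU : ∀ i, IsLipschitz fun p => χ p * U i p := fun i =>
    (isLipschitz_cutoff _).mul_of_bounded_support (hU i) fun _ => cutoff_eq_zero
  have hχW : ∀ i, IsLipschitz fun p => χ p * W i p := fun i =>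
    (isLipschitz_cutoff _).mul_of_bounded_support (hW i) fun _ => cutoff_eq_zero
  have h0 : ∀ i, ∫ p, jacobian (fun p => χ p * U i p) (fun p => χ p * W i p) p = 0 := fun i =>
    integral_jacobian_eq_zero (hχU i) (hasCompactSupport_cutoff_mul _ _) (hχW i)
      (hasCompactSupport_cutoff_mul _ _)
  have hint : ∀ i, Integrable (jacobian (fun p => χ p * U i p) (fun p => χ p * W i p)) := by
    intro i
    have := integrableOn_jacobian (hχU i) (hχW i)
      (s := Metric.closedBall 0 (r + l + 2)) (isCompact_closedBall _ _).measure_lt_top.ne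
    rwa [integrableOn_iff_integrable_of_support_subset] at this
    intro p hp
    by_contra hpb
    apply hp
    apply jacobian_eq_zero_of_fderiv_left
    have : (fun q => χ q * U i q) =ᶠ[𝓝 p] fun _ => 0 := by
      filter_upwards [Metric.isClosed_closedBall.isOpen_compl.mem_nhds hpb] with q hq
      simp only [mem_compl_iff, mem_closedBall_zero_iff, not_le] at hq
      simp [χ, cutoff_eq_zero hq.le]
    rw [this.fderiv_eq]
    simp
  -- Off the rectangle the summed form vanishes almost everywhere. Left of the spine the second
  -- functions coincide, so linearity in the first reduces the sum to the Jacobian of `∑ i, U i =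
  -- 0`; in the outer region one factor of each term is locally zero.
  have hae : (fun p => ∑ i, jacobian (fun p => χ p * U i p) (fun p => χ p * W i p) p) =ᵐ[volume]
      (openRect r l).indicator fun p => ∑ i, jacobian (U i) (W i) p := by
    filter_upwards [ae_mem_openRect_or r l, ae_all_iff.2 fun i => (hχU i).ae_differentiableAt]
      with p hp hd
    by_cases hpO : p ∈ openRect r l
    · rw [indicator_of_mem hpO]
      have hχ : ∀ᶠ q in 𝓝 p, χ q = 1 := by
        filter_upwards [(isOpen_openRect r l).mem_nhds hpO] with q hq
        exact cutoff_eq_one (by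
          linarith [norm_le_of_mem_closedRect (openRect_subset_closedRect r l hq)])
      refine Finset.sum_congr rfl fun i _ => jacobian_congr ?_ ?_ <;>
      · filter_upwards [hχ] with q hq
        rw [hq, one_mul]
    rw [indicator_of_notMem hpO]
    rcases hp.resolve_left hpO with hp | hp
    · have e : ∀ i, jacobian (fun p => χ p * U i p) (fun p => χ p * W i p) p =
          jacobian (fun p => χ p * U i p) (fun p => χ p * w p) p := fun i => by
        refine jacobian_congr EventuallyEq.rfl ?_
        filter_upwards [isOpen_leftHalf.mem_nhds hp] with q hq
        rw [hWl i q hq]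
      simp only [e]
      rw [← jacobian_sum_left _ fun i _ => hd i]
      apply jacobian_eq_zero_of_fderiv_left
      have : (fun q => ∑ i, χ q * U i q) =ᶠ[𝓝 p] fun _ => 0 := by
        filter_upwards [isOpen_leftHalf.mem_nhds hp] with q hq
        rw [← Finset.mul_sum, hUl q hq, mul_zero]
      rw [this.fderiv_eq]
      simp
    · refine Finset.sum_eq_zero fun i _ => ?_
      have aux : ∀ V : Plane → ℝ, (∀ p ∈ outerRegion r l, V p = 0) →
          fderiv ℝ (fun q => χ q * V q) p = 0 := fun V hV => by
        have : (fun q => χ q * V q) =ᶠ[𝓝 p] fun _ => 0 := by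
          filter_upwards [(isOpen_outerRegion r l).mem_nhds hp] with q hq
          rw [hV q hq, mul_zero]
        rw [this.fderiv_eq]
        simp
      rcases hout i with h | h
      · exact jacobian_eq_zero_of_fderiv_left (aux _ h)
      · exact jacobian_eq_zero_of_fderiv_right (aux _ h)
  have h1 : ∫ p, ∑ i, jacobian (fun p => χ p * U i p) (fun p => χ p * W i p) p = 0 := by
    rw [integral_finsetSum _ fun i _ => hint i]
    exact Finset.sum_eq_zero fun i _ => h0 i
  rw [integral_congr_ae hae, integral_indicator (isOpen_openRect r l).measurableSet,
    integral_finsetSum _ fun i _ =>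
      integrableOn_jacobian (hU i) (hW i) (volume_openRect_ne_top r l)] at h1
  exact h1

/-! ### The area inequality -/

/-- The pair of coordinates of a point of space with respect to two vectors. -/
noncomputable def frameMap (a b : R3) : R3 →L[ℝ] Plane :=
  (EuclideanSpace.equiv (Fin 2) ℝ).symm.toContinuousLinearMap ∘L
    ContinuousLinearMap.pi ![innerSL ℝ a, innerSL ℝ b]

@[simp] theorem frameMap_apply_zero (a b x : R3) : frameMap a b x 0 = inner ℝ a x := rfl

@[simp] theorem frameMap_apply_one (a b x : R3) : frameMap a b x 1 = inner ℝ b x := rfl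

/-- Bessel's inequality: coordinates with respect to an orthonormal pair are a contraction, hence do
not increase Hausdorff measure. -/
theorem lipschitzWith_frameMap {a b : R3} (ha : ‖a‖ = 1) (hb : ‖b‖ = 1) (hab : inner ℝ a b = 0) :
    LipschitzWith 1 (frameMap a b) := by
  have h : ‖frameMap a b‖ ≤ 1 := by
    refine ContinuousLinearMap.opNorm_le_bound _ zero_le_one fun x => ?_
    rw [one_mul, EuclideanSpace.norm_eq, Real.sqrt_le_left (norm_nonneg _)]
    simp only [Fin.sum_univ_two, frameMap_apply_zero, frameMap_apply_one, Real.norm_eq_abs, sq_abs,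
      real_inner_comm x]
    have h1 : 0 ≤ ‖x - (inner ℝ a x • a + inner ℝ b x • b)‖ ^ 2 := sq_nonneg _
    rw [norm_sub_sq_real, norm_add_sq_real, norm_smul, norm_smul, ha, hb, inner_add_right] at h1
    simp only [inner_smul_left, inner_smul_right, hab, real_inner_comm x, mul_one, Real.norm_eq_abs,
      sq_abs, conj_trivial] at h1
    nlinarith
  exact (frameMap a b).lipschitz.weaken (NNReal.coe_le_coe.1 (by simpa using h))

theorem euclideanHausdorffMeasure_image_le {X Y : Type*} [MetricSpace X] [MeasurableSpace X]
    [BorelSpace X] [MetricSpace Y] [MeasurableSpace Y] [BorelSpace Y] {g : X → Y}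
    (hg : LipschitzWith 1 g) (d : ℕ) (s : Set X) : μHE[d] (g '' s) ≤ μHE[d] s := by
  simp only [Measure.euclideanHausdorffMeasure_def, Measure.smul_apply]
  have := hg.hausdorffMeasure_image_le (d := (d : ℝ)) (by positivity) s
  rw [ENNReal.coe_one, ENNReal.one_rpow, one_mul] at this
  gcongr

/-- The Jacobian of the coordinates of `F` with respect to the vectors `a` and `b`. -/
noncomputable def pairJacobian (F : Plane → R3) (a b : R3) (p : Plane) : ℝ :=
  jacobian (fun q => inner ℝ a (F q)) (fun q => inner ℝ b (F q)) p

theorem IsLipschitz.inner_left {X : Type*} [PseudoEMetricSpace X] {F : X → R3} (hF : IsLipschitz F)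
    (a : R3) : IsLipschitz fun q => inner ℝ a (F q) :=
  (IsLipschitz.clm (innerSL ℝ a)).comp hF

theorem measurable_pairJacobian (F : Plane → R3) (a b : R3) : Measurable (pairJacobian F a b) :=
  measurable_jacobian _ _

theorem fderiv_inner_left {F : Plane → R3} {p : Plane} (hF : DifferentiableAt ℝ F p) (a : R3)
    (x : Plane) : fderiv ℝ (fun q => inner ℝ a (F q)) p x = inner ℝ a (fderiv ℝ F p x) := by
  have : HasFDerivAt (fun q => inner ℝ a (F q)) ((innerSL ℝ a) ∘L fderiv ℝ F p) p :=
    (innerSL ℝ a).hasFDerivAt.comp p hF.hasFDerivAt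
  rw [this.fderiv]
  rfl

theorem pairJacobian_eq {F : Plane → R3} {p : Plane} (hF : DifferentiableAt ℝ F p) (a b : R3) :
    pairJacobian F a b p =
      inner ℝ a (fderiv ℝ F p (EuclideanSpace.single 0 1)) *
        inner ℝ b (fderiv ℝ F p (EuclideanSpace.single 1 1)) -
      inner ℝ a (fderiv ℝ F p (EuclideanSpace.single 1 1)) *
        inner ℝ b (fderiv ℝ F p (EuclideanSpace.single 0 1)) := by
  simp only [pairJacobian, jacobian, fderiv_inner_left hF]

theorem det_plane (L : Plane →L[ℝ] Plane) :
    L.det = L (EuclideanSpace.single 0 1) 0 * L (EuclideanSpace.single 1 1) 1 -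
      L (EuclideanSpace.single 1 1) 0 * L (EuclideanSpace.single 0 1) 1 := by
  rw [ContinuousLinearMap.det, ← LinearMap.det_toMatrix (EuclideanSpace.basisFun (Fin 2) ℝ).toBasis,
    Matrix.det_fin_two]
  simp [LinearMap.toMatrix_apply]

/-- The area inequality: the area of an injective Lipschitz image is at least the integral of the
absolute Jacobian of an orthonormal pair of coordinates. -/
theorem lintegral_abs_pairJacobian_le {F : Plane → R3} (hF : IsLipschitz F) {A : Set Plane}
    (hA : MeasurableSet A) (hinj : InjOn F A) {a b : R3} (ha : ‖a‖ = 1) (hb : ‖b‖ = 1)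
    (hab : inner ℝ a b = 0) :
    ∫⁻ p in A, ENNReal.ofReal |pairJacobian F a b p| ≤ μHE[2] (F '' A) := by
  set h : Plane → Plane := fun p => frameMap a b (F p) with hh
  set h' : Plane → Plane →L[ℝ] Plane := fun p => frameMap a b ∘L fderiv ℝ F p
  have hJ : ∀ p, DifferentiableAt ℝ F p → pairJacobian F a b p = (h' p).det := fun p hp => by
    rw [pairJacobian_eq hp, det_plane]
    simp [h']
  -- Points of zero Jacobian contribute nothing and points of non-differentiability form a null set.
  -- On what remains the derivative of the projected map `h` is invertible.
  set s : Set Plane := A ∩ ({p | DifferentiableAt ℝ F p} ∩ {p | pairJacobian F a b p ≠ 0}) with hs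
  have hsm : MeasurableSet s :=
    hA.inter ((measurableSet_of_differentiableAt ℝ F).inter
      (measurable_pairJacobian F a b (measurableSet_singleton 0)).compl)
  have hh' : ∀ p ∈ s, HasFDerivWithinAt h (h' p) s p := fun p hp =>
    ((frameMap a b).hasFDerivAt.comp p hp.2.1.hasFDerivAt).hasFDerivWithinAt
  have hred : ∫⁻ p in A, ENNReal.ofReal |pairJacobian F a b p| =
      ∫⁻ p in s, ENNReal.ofReal |(h' p).det| := by
    rw [← lintegral_indicator hA, ← lintegral_indicator hsm]
    refine lintegral_congr_ae ?_
    filter_upwards [hF.ae_differentiableAt] with p hp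
    by_cases hpA : p ∈ A
    · by_cases h0 : pairJacobian F a b p = 0
      · rw [indicator_of_mem hpA, indicator_of_notMem (fun hps => hps.2.2 h0), h0]
        simp
      · rw [indicator_of_mem hpA, indicator_of_mem (show p ∈ s from ⟨hpA, hp, h0⟩), hJ p hp]
    · rw [indicator_of_notMem hpA, indicator_of_notMem fun hps => hpA hps.1]
  rw [hred]
  rcases s.eq_empty_or_nonempty with hse | hsne
  · rw [hse]
    simp
  -- The map `h` need not be injective even though `F` is. A map that approximates an invertible `L`
  -- with error less than `‖L⁻¹‖⁻¹` is injective, so half of this bound yields countably many pieces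
  -- on which the change of variables formula applies. Injectivity of `F` makes the images of the
  -- pieces in space disjoint, so their areas add.
  have hr : ∀ L : Plane →L[ℝ] Plane, ∃ δ : NNReal, δ ≠ 0 ∧ (L.det ≠ 0 → ∀ (t : Set Plane),
      ApproximatesLinearOn h L t δ → InjOn h t) := fun L => by
    by_cases hL : L.det = 0
    · exact ⟨1, one_ne_zero, fun h => (h hL).elim⟩
    · obtain ⟨B, hB⟩ : ∃ B : Plane ≃L[ℝ] Plane, (B : Plane →L[ℝ] Plane) = L :=
        ⟨L.toContinuousLinearEquivOfDetNeZero hL, by ext; simp⟩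
      have hpos : 0 < ‖(B.symm : Plane →L[ℝ] Plane)‖₊ := by
        have := B.subsingleton_or_nnnorm_symm_pos
        exact this.resolve_left (not_subsingleton _)
      refine ⟨‖(B.symm : Plane →L[ℝ] Plane)‖₊⁻¹ / 2, by positivity, fun _ t ht => ?_⟩
      rw [← hB] at ht
      exact ht.injOn (Or.inr (NNReal.half_lt_self (by positivity)))
  choose δ hδ0 hδ using hr
  obtain ⟨t, L, htd, htm, hst, hta, hL⟩ :=
    exists_partition_approximatesLinearOn_of_hasFDerivWithinAt h s h' hh' δ hδ0
  have hinjn : ∀ k, InjOn h (s ∩ t k) := fun k => by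
    obtain ⟨p, hp, hLp⟩ := hL hsne k
    refine hδ (L k) ?_ _ (hta k)
    rw [hLp, ← hJ p hp.2.1]
    exact hp.2.2
  have hstm : ∀ k, MeasurableSet (s ∩ t k) := fun k => hsm.inter (htm k)
  have hsu : s = ⋃ k, s ∩ t k := by rw [← inter_iUnion, inter_eq_left.2 hst]
  have hpiece : ∀ k, ∫⁻ p in s ∩ t k, ENNReal.ofReal |(h' p).det| ≤ μHE[2] (F '' (s ∩ t k)) := by
    intro k
    rw [lintegral_abs_det_fderiv_eq_addHaar_image volume (hstm k)
      (fun p hp => (hh' p hp.1).mono inter_subset_left) (hinjn k),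
      ← EuclideanSpace.euclideanHausdorffMeasure_eq_volume 2, hh, ← image_image]
    exact euclideanHausdorffMeasure_image_le (lipschitzWith_frameMap ha hb hab) 2 _
  calc ∫⁻ p in s, ENNReal.ofReal |(h' p).det|
      = ∑' k, ∫⁻ p in s ∩ t k, ENNReal.ofReal |(h' p).det| := by
        conv_lhs => rw [hsu]
        exact lintegral_iUnion hstm (fun i j hij => (htd hij).mono inter_subset_right
          inter_subset_right) _
    _ ≤ ∑' k, μHE[2] (F '' (s ∩ t k)) := ENNReal.tsum_le_tsum hpiece
    _ = μHE[2] (⋃ k, F '' (s ∩ t k)) := by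
        refine (measure_iUnion (fun i j hij => ?_) fun k => ?_).symm
        · exact (disjoint_image_image fun x hx y hy hxy => by
            have := hinj hx.1.1 hy.1.1 hxy
            exact disjoint_left.1 (htd hij) hx.2 (this ▸ hy.2))
        · exact (hstm k).image_of_continuousOn_injOn hF.continuous.continuousOn
            (hinj.mono (inter_subset_left.trans inter_subset_left))
    _ ≤ μHE[2] (F '' A) := measure_mono (iUnion_subset fun k =>
        image_mono (inter_subset_left.trans inter_subset_left))

/-- The area inequality for the larger one of two Jacobians. -/
theorem lintegral_max_abs_pairJacobian_le {F : Plane → R3} (hF : IsLipschitz F) {A : Set Plane}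
    (hA : MeasurableSet A) (hinj : InjOn F A) {a b c d : R3} (ha : ‖a‖ = 1) (hb : ‖b‖ = 1)
    (hab : inner ℝ a b = 0) (hc : ‖c‖ = 1) (hd : ‖d‖ = 1) (hcd : inner ℝ c d = 0) :
    ∫⁻ p in A, ENNReal.ofReal (max |pairJacobian F a b p| |pairJacobian F c d p|) ≤
      μHE[2] (F '' A) := by
  set B := {p | |pairJacobian F a b p| ≤ |pairJacobian F c d p|}
  have hB : MeasurableSet B := measurableSet_le (measurable_pairJacobian F a b).abs
    (measurable_pairJacobian F c d).abs
  rw [← lintegral_inter_add_sdiff _ A hB]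
  have h1 : ∫⁻ p in A ∩ B, ENNReal.ofReal (max |pairJacobian F a b p| |pairJacobian F c d p|) ≤
      μHE[2] (F '' (A ∩ B)) := by
    rw [setLIntegral_congr_fun (hA.inter hB) fun p hp => by rw [max_eq_right hp.2]]
    exact lintegral_abs_pairJacobian_le hF (hA.inter hB) (hinj.mono inter_subset_left) hc hd hcd
  have h2 : ∫⁻ p in A \ B, ENNReal.ofReal (max |pairJacobian F a b p| |pairJacobian F c d p|) ≤
      μHE[2] (F '' (A \ B)) := by
    rw [setLIntegral_congr_fun (hA.diff hB) fun p hp => by rw [max_eq_left (not_le.1 hp.2).le]]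
    exact lintegral_abs_pairJacobian_le hF (hA.diff hB) (hinj.mono sdiff_subset) ha hb hab
  refine (add_le_add h1 h2).trans ?_
  rw [← measure_union]
  · exact measure_mono (union_subset (image_mono inter_subset_left) (image_mono sdiff_subset))
  · exact disjoint_image_image fun x hx y hy hxy =>
      hy.2 (hinj hx.1 hy.1 hxy ▸ hx.2)
  · exact (hA.diff hB).image_of_continuousOn_injOn hF.continuous.continuousOn
      (hinj.mono sdiff_subset)

/-! ### Geometry of the pages and their extension beyond the rectangle -/

theorem norm_vertical : ‖vertical‖ = 1 := by simp [vertical]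

theorem inner_vertical_left (x : R3) : inner ℝ vertical x = x 2 := by
  simp [vertical, EuclideanSpace.inner_single_left]

theorem inner_vertical_right (x : R3) : inner ℝ x vertical = x 2 := by
  rw [real_inner_comm, inner_vertical_left]

@[simp] theorem vertical_zero : vertical 0 = 0 := by simp [vertical]

@[simp] theorem vertical_one : vertical 1 = 0 := by simp [vertical]

@[simp] theorem vertical_two : vertical 2 = 1 := by simp [vertical]

theorem inner_eq_sum (x y : R3) : inner ℝ x y = x 0 * y 0 + x 1 * y 1 + x 2 * y 2 := by
  simp [PiLp.inner_apply, Fin.sum_univ_three, mul_comm]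

theorem sq_add_sq_of_horizontal {u : R3} (hu : ‖u‖ = 1) (hu2 : u 2 = 0) :
    u 0 ^ 2 + u 1 ^ 2 = 1 := by
  have : inner ℝ u u = (1 : ℝ) := by rw [real_inner_self_eq_norm_sq, hu, one_pow]
  rw [inner_eq_sum, hu2] at this
  nlinarith

/-- The parametrization of the half-plane with direction `u`. -/
noncomputable def pageMap (u : R3) (p : Plane) : R3 := p 0 • u + p 1 • vertical

theorem pageMap_two {u : R3} (hu2 : u 2 = 0) (p : Plane) : pageMap u p 2 = p 1 := by
  simp [pageMap, hu2]

theorem isometry_pageMap {u : R3} (hu : ‖u‖ = 1) (hu2 : u 2 = 0) : Isometry (pageMap u) := by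
  refine Isometry.of_dist_eq fun p q => ?_
  have h := sq_add_sq_of_horizontal hu hu2
  rw [EuclideanSpace.dist_eq, EuclideanSpace.dist_eq]
  congr 1
  simp only [Fin.sum_univ_two, Fin.sum_univ_three, Real.dist_eq, sq_abs, pageMap, PiLp.add_apply,
    PiLp.smul_apply, smul_eq_mul, vertical_zero, vertical_one, vertical_two, hu2]
  linear_combination (p 0 - q 0) ^ 2 * h

theorem pageMap_mem_halfPlane (u : R3) {p : Plane} (hp : 0 ≤ p 0) : pageMap u p ∈ halfPlane u :=
  ⟨p 0, p 1, hp, rfl⟩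

theorem pageMap_mem_solidCylinder_iff {u : R3} (hu : ‖u‖ = 1) (hu2 : u 2 = 0) {r l : ℝ}
    {p : Plane} : pageMap u p ∈ solidCylinder r l ↔ p 0 ^ 2 ≤ r ^ 2 ∧ 0 ≤ p 1 ∧ p 1 ≤ l := by
  have h := sq_add_sq_of_horizontal hu hu2
  have e : pageMap u p 0 ^ 2 + pageMap u p 1 ^ 2 = p 0 ^ 2 := by
    simp only [pageMap, PiLp.add_apply, PiLp.smul_apply, smul_eq_mul, vertical_zero, vertical_one]
    linear_combination p 0 ^ 2 * h
  rw [solidCylinder, mem_ofPred_eq, e, pageMap_two hu2]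

theorem book_eq_iUnion {n : ℕ} {v : Fin n → R3} (hv : IsStationaryDirections v) {r : ℝ} (l : ℝ)
    (hr : 0 < r) : book v r l = ⋃ i, pageMap (v i) '' closedRect r l := by
  ext x
  simp only [book, mem_inter_iff, mem_iUnion, mem_image]
  constructor
  · rintro ⟨hx, i, t, s, ht, rfl⟩
    have e : t • v i + s • vertical = pageMap (v i) !₂[t, s] := by simp [pageMap]
    rw [e, pageMap_mem_solidCylinder_iff (hv.norm_eq_one i) (hv.horizontal i)] at hx
    obtain ⟨h1, h2, h3⟩ := hx
    exact ⟨i, !₂[t, s], ⟨ht, abs_le_of_sq_le_sq' h1 hr.le |>.2, h2, h3⟩, e.symm⟩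
  · rintro ⟨i, p, ⟨h0, h1, h2, h3⟩, rfl⟩
    exact ⟨(pageMap_mem_solidCylinder_iff (hv.norm_eq_one i) (hv.horizontal i)).2
      ⟨pow_le_pow_left₀ h0 h1 2, h2, h3⟩, i, pageMap_mem_halfPlane _ h0⟩

theorem euclideanHausdorffMeasure_pageMap_image {u : R3} (hu : ‖u‖ = 1) (hu2 : u 2 = 0)
    (s : Set Plane) : μHE[2] (pageMap u '' s) = volume s := by
  rw [(isometry_pageMap hu hu2).euclideanHausdorffMeasure_image,
    EuclideanSpace.euclideanHausdorffMeasure_eq_volume]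

theorem euclideanHausdorffMeasure_book_le {n : ℕ} {v : Fin n → R3} (hv : IsStationaryDirections v)
    {r : ℝ} (l : ℝ) (hr : 0 < r) : μHE[2] (book v r l) ≤ n * volume (openRect r l) := by
  rw [book_eq_iUnion hv l hr]
  refine (measure_iUnion_le _).trans ?_
  simp [euclideanHausdorffMeasure_pageMap_image, hv.norm_eq_one, hv.horizontal, volume_openRect]

theorem disjoint_pageMap_image {u u' : R3} (hu : ‖u‖ = 1) (hu2 : u 2 = 0) (hu' : ‖u'‖ = 1)
    (hu2' : u' 2 = 0) (hne : u ≠ u') (r l : ℝ) :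
    Disjoint (pageMap u '' openRect r l) (pageMap u' '' openRect r l) := by
  rw [disjoint_left]
  rintro _ ⟨p, hp, rfl⟩ ⟨q, hq, h⟩
  apply hne
  have h2 : q 1 = p 1 := by rw [← pageMap_two hu2' q, h, pageMap_two hu2]
  rw [pageMap, pageMap, h2, add_left_inj] at h
  have h3 := congrArg norm h
  rw [norm_smul, norm_smul, hu, hu', Real.norm_eq_abs, Real.norm_eq_abs, abs_of_pos hp.1,
    abs_of_pos hq.1, mul_one, mul_one] at h3
  rw [h3] at h
  exact (smul_right_injective R3 hp.1.ne' h).symm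

/-- The parametrization of a page, extended constantly beyond the sides of the rectangle. -/
noncomputable def clampedPage (u : R3) (r l : ℝ) (p : Plane) : R3 :=
  max 0 (min (p 0) r) • u + max 0 (min (p 1) l) • vertical

theorem isLipschitz_clamp (j : Fin 2) (c : ℝ) :
    IsLipschitz fun p : Plane => max 0 (min (p j) c) :=
  (IsLipschitz.const 0).max ((IsLipschitz.clm (EuclideanSpace.proj j)).min (IsLipschitz.const c))

theorem isLipschitz_clampedPage (u : R3) (r l : ℝ) : IsLipschitz (clampedPage u r l) :=
  ((IsLipschitz.clm (ContinuousLinearMap.toSpanSingleton ℝ u)).comp (isLipschitz_clamp 0 r)).add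
    ((IsLipschitz.clm (ContinuousLinearMap.toSpanSingleton ℝ vertical)).comp (isLipschitz_clamp 1 l))

theorem clamp_eq_self {t c : ℝ} (h0 : 0 ≤ t) (h1 : t ≤ c) : max 0 (min t c) = t := by
  rw [min_eq_left h1, max_eq_right h0]

theorem clamp_of_neg {t c : ℝ} (h0 : t < 0) : max 0 (min t c) = 0 :=
  max_eq_left ((min_le_left _ _).trans h0.le)

theorem clampedPage_of_mem {u : R3} {r l : ℝ} {p : Plane} (hp : p ∈ closedRect r l) :
    clampedPage u r l p = pageMap u p := by
  rw [clampedPage, pageMap, clamp_eq_self hp.1 hp.2.1, clamp_eq_self hp.2.2.1 hp.2.2.2]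

theorem inner_clampedPage {u : R3} (hu : ‖u‖ = 1) (hu2 : u 2 = 0) (r l : ℝ) (p : Plane) :
    inner ℝ u (clampedPage u r l p) = max 0 (min (p 0) r) := by
  rw [clampedPage, inner_add_right, inner_smul_right, inner_smul_right, inner_vertical_right, hu2,
    real_inner_self_eq_norm_sq, hu]
  ring

theorem inner_vertical_clampedPage {u : R3} (hu2 : u 2 = 0) (r l : ℝ) (p : Plane) :
    inner ℝ vertical (clampedPage u r l p) = max 0 (min (p 1) l) := by
  rw [inner_vertical_left]
  simp [clampedPage, hu2]

theorem exists_add_smul_mem_of_mem_interior {E : Type*} [NormedAddCommGroup E] [NormedSpace ℝ E]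
    {s : Set E} {x : E} (hx : x ∈ interior s) (w : E) : ∃ ε : ℝ, 0 < ε ∧ x + ε • w ∈ s := by
  have h : Tendsto (fun ε : ℝ => x + ε • w) (𝓝[>] 0) (𝓝 x) := by
    have : Tendsto (fun ε : ℝ => x + ε • w) (𝓝 0) (𝓝 (x + (0 : ℝ) • w)) :=
      (by fun_prop : Continuous fun ε : ℝ => x + ε • w).tendsto 0
    rw [zero_smul, add_zero] at this
    exact this.mono_left nhdsWithin_le_nhds
  obtain ⟨ε, h1, h2⟩ := ((h.eventually (mem_interior_iff_mem_nhds.1 hx)).and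
    self_mem_nhdsWithin).exists
  exact ⟨ε, h2, h1⟩

theorem clampedPage_mem_frontier {u : R3} (hu : ‖u‖ = 1) (hu2 : u 2 = 0) {r l : ℝ} (hr : 0 < r)
    (hl : 0 < l) {p : Plane} (hp : p ∈ outerRegion r l) :
    clampedPage u r l p ∈ frontier (solidCylinder r l) := by
  set q : Plane := !₂[max 0 (min (p 0) r), max 0 (min (p 1) l)] with hq
  have hq0 : 0 ≤ q 0 := le_max_left _ _
  have hq0' : q 0 ≤ r := max_le hr.le (min_le_right _ _)
  have hq1 : 0 ≤ q 1 := le_max_left _ _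
  have hq1' : q 1 ≤ l := max_le hl.le (min_le_right _ _)
  have e : clampedPage u r l p = pageMap u q := by simp [clampedPage, pageMap, q]
  have hmem : pageMap u q ∈ solidCylinder r l :=
    (pageMap_mem_solidCylinder_iff hu hu2).2 ⟨pow_le_pow_left₀ hq0 hq0' 2, hq1, hq1'⟩
  rw [e]
  refine ⟨subset_closure hmem, fun hint => ?_⟩
  -- An interior point could be moved slightly in any direction of the page. Moving outwards,
  -- downwards or upwards contradicts this on the respective side.
  have key : ∀ a b : ℝ, ∃ ε : ℝ, 0 < ε ∧ (q 0 + ε * a) ^ 2 ≤ r ^ 2 ∧ 0 ≤ q 1 + ε * b ∧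
      q 1 + ε * b ≤ l := fun a b => by
    obtain ⟨ε, hε, h⟩ := exists_add_smul_mem_of_mem_interior hint (a • u + b • vertical)
    have e' : pageMap u q + ε • (a • u + b • vertical) =
        pageMap u !₂[q 0 + ε * a, q 1 + ε * b] := by
      simp only [pageMap, Matrix.cons_val_zero, Matrix.cons_val_one]
      module
    rw [e', pageMap_mem_solidCylinder_iff hu hu2] at h
    exact ⟨ε, hε, h⟩
  rcases hp with hp | hp | hp
  · have : q 0 = r := by simp [q, min_eq_right hp.le, hr.le]
    obtain ⟨ε, hε, h, -⟩ := key 1 0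
    rw [this] at h
    nlinarith
  · have : q 1 = 0 := by simp [q, hp.le]
    obtain ⟨ε, hε, -, h, -⟩ := key 0 (-1)
    rw [this] at h
    linarith
  · have : q 1 = l := by simp [q, min_eq_right hp.le, hl.le]
    obtain ⟨ε, hε, -, -, h⟩ := key 0 1
    rw [this] at h
    linarith

theorem clampedPage_mem_edgeSet {n : ℕ} {v : Fin n → R3} (hv : IsStationaryDirections v) {r l : ℝ}
    (hr : 0 < r) (hl : 0 < l) (i : Fin n) {p : Plane} (hp : p ∈ outerRegion r l) :
    clampedPage (v i) r l p ∈ edgeSet v r l :=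
  ⟨clampedPage_mem_frontier (hv.norm_eq_one i) (hv.horizontal i) hr hl hp,
    mem_iUnion.2 ⟨i, _, _, le_max_left _ _, rfl⟩⟩

/-! ### Images of the pages and the flux identity -/

/-- The image of the extended page with direction `u` under `f`. -/
noncomputable def pageImage (f : R3 → R3) (u : R3) (r l : ℝ) (p : Plane) : R3 :=
  f (clampedPage u r l p)

theorem isLipschitz_pageImage {f : R3 → R3} (hf : IsLipschitz f) (u : R3) (r l : ℝ) :
    IsLipschitz (pageImage f u r l) :=
  hf.comp (isLipschitz_clampedPage u r l)

theorem pageImage_of_mem {f : R3 → R3} {u : R3} {r l : ℝ} {p : Plane} (hp : p ∈ closedRect r l) :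
    pageImage f u r l p = f (pageMap u p) := by
  rw [pageImage, clampedPage_of_mem hp]

theorem pageImage_of_neg {f : R3 → R3} {u : R3} {r l : ℝ} {p : Plane} (hp : p 0 < 0) :
    pageImage f u r l p = f (max 0 (min (p 1) l) • vertical) := by
  rw [pageImage, clampedPage, clamp_of_neg hp, zero_smul, zero_add]

theorem image_pageImage_openRect (f : R3 → R3) (u : R3) (r l : ℝ) :
    pageImage f u r l '' openRect r l = f '' (pageMap u '' openRect r l) := by
  rw [image_image]
  exact image_congr fun p hp => pageImage_of_mem (openRect_subset_closedRect r l hp)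

theorem injOn_pageImage {f : R3 → R3} (hf : f.Injective) {u : R3} (hu : ‖u‖ = 1) (hu2 : u 2 = 0)
    (r l : ℝ) : InjOn (pageImage f u r l) (openRect r l) := by
  intro p hp q hq h
  rw [pageImage_of_mem (openRect_subset_closedRect r l hp),
    pageImage_of_mem (openRect_subset_closedRect r l hq)] at h
  exact (isometry_pageMap hu hu2).injective (hf h)

theorem sum_euclideanHausdorffMeasure_pageImage_le {n : ℕ} {v : Fin n → R3}
    (hv : IsStationaryDirections v) {r : ℝ} (l : ℝ) (hr : 0 < r) {f : R3 → R3}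
    (hf : IsLipschitz f) (hfi : f.Injective) :
    ∑ i, μHE[2] (pageImage f (v i) r l '' openRect r l) ≤ μHE[2] (f '' book v r l) := by
  rw [← tsum_fintype (L := SummationFilter.unconditional _), ← measure_iUnion]
  · refine measure_mono (iUnion_subset fun i => ?_)
    rw [image_pageImage_openRect, book_eq_iUnion hv l hr]
    exact image_mono ((image_mono (openRect_subset_closedRect r l)).trans
      (subset_iUnion (fun i => pageMap (v i) '' closedRect r l) i))
  · intro i j hij
    simp only [Function.onFun, image_pageImage_openRect]
    exact (disjoint_image_iff hfi).2 (disjoint_pageMap_image (hv.norm_eq_one i) (hv.horizontal i)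
      (hv.norm_eq_one j) (hv.horizontal j) (hv.injective.ne hij) r l)
  · exact fun i => (isOpen_openRect r l).measurableSet.image_of_continuousOn_injOn
      (isLipschitz_pageImage hf _ r l).continuous.continuousOn
      (injOn_pageImage hfi (hv.norm_eq_one i) (hv.horizontal i) r l)

theorem jacobian_coord (p : Plane) : jacobian (fun q => q 0) (fun q => q 1) p = 1 := by
  have h : ∀ j : Fin 2, fderiv ℝ (fun q : Plane => q j) p = EuclideanSpace.proj j := fun j =>
    (EuclideanSpace.proj j : Plane →L[ℝ] ℝ).fderiv
  simp [jacobian, h]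

theorem jacobian_sub_left {u u' w : Plane → ℝ} {p : Plane} (hu : DifferentiableAt ℝ u p)
    (hu' : DifferentiableAt ℝ u' p) :
    jacobian (fun q => u q - u' q) w p = jacobian u w p - jacobian u' w p := by
  simp only [jacobian, fderiv_fun_sub hu hu', sub_apply]
  ring

theorem jacobian_sub_right {u w w' : Plane → ℝ} {p : Plane} (hw : DifferentiableAt ℝ w p)
    (hw' : DifferentiableAt ℝ w' p) :
    jacobian u (fun q => w q - w' q) p = jacobian u w p - jacobian u w' p := by
  simp only [jacobian, fderiv_fun_sub hw hw', sub_apply]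
  ring

/-- The flux identity: the vertical directions calibrate the book. -/
theorem sum_integral_pairJacobian {n : ℕ} {v : Fin n → R3} (hv : IsStationaryDirections v)
    {r l : ℝ} (hr : 0 < r) (hl : 0 < l) {f : R3 → R3} (hf : IsLipschitz f)
    (hfix : ∀ p ∈ edgeSet v r l, f p = p) :
    ∑ i, ∫ p in openRect r l, pairJacobian (pageImage f (v i) r l) (v i) vertical p =
      n * (volume (openRect r l)).toReal := by
  set T : Plane → ℝ := fun p => max 0 (min (p 0) r)
  set S : Plane → ℝ := fun p => max 0 (min (p 1) l)
  set U : Fin n → Plane → ℝ := fun i p => inner ℝ (v i) (pageImage f (v i) r l p)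
  set W : Fin n → Plane → ℝ := fun i p => inner ℝ vertical (pageImage f (v i) r l p)
  have hT : IsLipschitz T := isLipschitz_clamp 0 r
  have hS : IsLipschitz S := isLipschitz_clamp 1 l
  have hU : ∀ i, IsLipschitz (U i) := fun i => (isLipschitz_pageImage hf _ r l).inner_left _
  have hW : ∀ i, IsLipschitz (W i) := fun i => (isLipschitz_pageImage hf _ r l).inner_left _
  -- `T` and `S` are the values of `U i` and `W i` for the identity map. The splitting is `dU ∧ dW =
  -- d(U - T) ∧ dW + dT ∧ d(W - S) + dT ∧ dS`. The first term sums to zero since `U i - T` vanishes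
  -- beyond the sides and adds up to zero at the spine; the second since `T` vanishes at the spine
  -- and `W i - S` beyond the sides; the third has Jacobian one.
  have h1 := sum_integral_jacobian_eq_zero (r := r) (l := l) (U := fun i p => U i p - T p) (W := W)
    (w := fun p => inner ℝ vertical (f (S p • vertical)))
    (fun i => (hU i).sub hT) hW
    (fun p hp => by
      simp only [U, T, pageImage_of_neg hp, clamp_of_neg hp, sub_zero]
      rw [← sum_inner, hv.sum_eq_zero, inner_zero_left])
    (fun i p hp => by simp only [W, S, pageImage_of_neg hp])
    (fun i => Or.inl fun p hp => by
      simp only [U, T, pageImage, hfix _ (clampedPage_mem_edgeSet hv hr hl i hp),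
        inner_clampedPage (hv.norm_eq_one i) (hv.horizontal i), sub_self])
  have h2 := sum_integral_jacobian_eq_zero (r := r) (l := l) (U := fun _ : Fin n => T)
    (W := fun i p => W i p - S p)
    (w := fun p => inner ℝ vertical (f (S p • vertical)) - S p)
    (fun _ => hT) (fun i => (hW i).sub hS)
    (fun p hp => by simp only [T, clamp_of_neg hp, Finset.sum_const_zero])
    (fun i p hp => by simp only [W, S, pageImage_of_neg hp])
    (fun i => Or.inr fun p hp => by
      simp only [W, S, pageImage, hfix _ (clampedPage_mem_edgeSet hv hr hl i hp),
        inner_vertical_clampedPage (hv.horizontal i), sub_self])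
  have hO := volume_openRect_ne_top r l
  have h3 : ∀ i, ∫ p in openRect r l, pairJacobian (pageImage f (v i) r l) (v i) vertical p =
      (∫ p in openRect r l, jacobian (fun p => U i p - T p) (W i) p) +
      (∫ p in openRect r l, jacobian T (fun p => W i p - S p) p) +
      ∫ p in openRect r l, (1 : ℝ) := fun i => by
    have hA := integrableOn_jacobian ((hU i).sub hT) (hW i) hO
    have hB := integrableOn_jacobian hT ((hW i).sub hS) hO
    have hAB : IntegrableOn (fun p => jacobian (fun p => U i p - T p) (W i) p +
      jacobian T (fun p => W i p - S p) p) (openRect r l) := hA.add hB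
    rw [← integral_add hA hB, ← integral_add hAB (integrableOn_const hO)]
    refine setIntegral_congr_ae (isOpen_openRect r l).measurableSet ?_
    filter_upwards [(hU i).ae_differentiableAt, (hW i).ae_differentiableAt,
      hT.ae_differentiableAt, hS.ae_differentiableAt] with p dU dW dT dS hp
    have hTS : jacobian T S p = 1 := by
      rw [← jacobian_coord p]
      refine jacobian_congr ?_ ?_ <;>
      · filter_upwards [(isOpen_openRect r l).mem_nhds hp] with q hq
        obtain ⟨a1, a2, a3, a4⟩ := openRect_subset_closedRect r l hq
        simp only [T, S]
        exact clamp_eq_self ‹_› ‹_›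
    rw [jacobian_sub_left dU dT, jacobian_sub_right dW dS, hTS]
    simp only [pairJacobian, U, W]
    ring
  simp only [h3, Finset.sum_add_distrib]
  rw [h1, h2]
  simp [Measure.real]

/-! ### From almost everywhere to everywhere on the rectangle -/

theorem closedRect_subset_closure {r l : ℝ} (hr : 0 < r) (hl : 0 < l) :
    closedRect r l ⊆ closure (openRect r l) := by
  intro p hp
  obtain ⟨h0, h1, h2, h3⟩ := hp
  set c : Plane := !₂[r / 2, l / 2]
  have ht : Tendsto (fun ε : ℝ => p + ε • (c - p)) (𝓝[>] 0) (𝓝 p) := by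
    have : Tendsto (fun ε : ℝ => p + ε • (c - p)) (𝓝 0) (𝓝 (p + (0 : ℝ) • (c - p))) :=
      (by fun_prop : Continuous fun ε : ℝ => p + ε • (c - p)).tendsto 0
    rw [zero_smul, add_zero] at this
    exact this.mono_left nhdsWithin_le_nhds
  refine mem_closure_of_tendsto ht ?_
  filter_upwards [Ioo_mem_nhdsGT one_pos] with ε hε
  obtain ⟨e0, e1⟩ := hε
  simp only [openRect, mem_ofPred_eq, PiLp.add_apply, PiLp.smul_apply, PiLp.sub_apply, smul_eq_mul, c,
    Matrix.cons_val_zero, Matrix.cons_val_one]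
  refine ⟨?_, ?_, ?_, ?_⟩ <;> nlinarith

/-- A nonempty open set has positive measure, so a closed condition that holds almost everywhere in
the open rectangle holds throughout it, and then on its closure. -/
theorem mem_of_isClosed_of_ae {r l : ℝ} (hr : 0 < r) (hl : 0 < l) {P : Set Plane}
    (hP : IsClosed P) (h : ∀ᵐ p, p ∈ openRect r l → p ∈ P) {p : Plane} (hp : p ∈ closedRect r l) :
    p ∈ P := by
  have h0 : openRect r l ∩ Pᶜ = ∅ := by
    rw [← ((isOpen_openRect r l).inter hP.isOpen_compl).measure_eq_zero_iff volume]
    refine measure_mono_null (fun q hq => ?_) (ae_iff.1 h)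
    simp only [mem_ofPred_eq, Classical.not_imp]
    exact hq
  have h1 : openRect r l ⊆ P := fun q hq => by
    by_contra hqP
    exact h0.subset ⟨hq, hqP⟩
  exact closure_minimal h1 hP (closedRect_subset_closure hr hl hp)

/-- A Lipschitz function that vanishes beyond the sides of the rectangle and has zero derivative in
the rectangle is zero there. -/
theorem eq_zero_of_fderiv_eq_zero {r l : ℝ} (hr : 0 < r) (hl : 0 < l) {ψ : Plane → ℝ}
    (hψ : IsLipschitz ψ) (hout : ∀ p ∈ outerRegion r l, ψ p = 0)
    (hd : ∀ᵐ p, p ∈ openRect r l → fderiv ℝ ψ p = 0) {p : Plane} (hp : p ∈ closedRect r l) :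
    ψ p = 0 := by
  set χ := cutoff (r + l + 2)
  have hA : IsLipschitz fun p => χ p * max (p 0) 0 :=
    (isLipschitz_cutoff _).mul_of_bounded_support
      ((IsLipschitz.clm (EuclideanSpace.proj 0 : Plane →L[ℝ] ℝ)).max (IsLipschitz.const 0)) fun _ => cutoff_eq_zero
  -- Testing the zero derivative against `x₀ ψ` gives `∫ ψ² = 0`, because `∂₀ (x₀ ψ) = ψ` in the
  -- rectangle. The positive part of `x₀` removes the spine, where nothing is known about `ψ`, and
  -- the cutoff provides compact support.
  set g : Plane → ℝ := fun p => χ p * max (p 0) 0 * ψ p with hg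
  have hgl : IsLipschitz g := hA.mul_of_bounded_support hψ (M := r + l + 2) fun p hp => by
    simp [χ, cutoff_eq_zero hp]
  have hgs : HasCompactSupport g := by
    have := hasCompactSupport_cutoff_mul (r + l + 2) fun p => max (p 0) 0 * ψ p
    simpa only [hg, χ, mul_assoc] using this
  set e : Plane := EuclideanSpace.single 0 1
  have h1 := hψ.choose_spec.integral_lineDeriv_mul_eq (μ := volume) hgl.choose_spec hgs e
  have hgl0 : ∀ q : Plane, q 0 < 0 → g q = 0 := fun q hq => by simp [g, max_eq_right hq.le]
  have hgo : ∀ q ∈ outerRegion r l, g q = 0 := fun q hq => by simp [g, hout q hq]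
  have hL : ∫ p, lineDeriv ℝ ψ p e * g p = 0 := by
    refine integral_eq_zero_of_ae ?_
    filter_upwards [hψ.ae_differentiableAt, hd, ae_mem_openRect_or r l] with q hq hq0 hqc
    rcases hqc with h | h | h
    · simp [hq.lineDeriv_eq_fderiv, hq0 h]
    · simp [hgl0 q h]
    · simp [hgo q h]
  have hR : (fun p => lineDeriv ℝ g p (-e) * ψ p) =ᵐ[volume]
      (openRect r l).indicator fun p => -(ψ p) ^ 2 := by
    filter_upwards [hψ.ae_differentiableAt, hd, ae_mem_openRect_or r l] with q hq hq0 hqc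
    have aux : ∀ s : Set Plane, IsOpen s → (∀ q ∈ s, g q = 0) → q ∈ s →
        lineDeriv ℝ g q (-e) = 0 := fun s hs hs0 hqs => by
      have : g =ᶠ[𝓝 q] fun _ => 0 := by
        filter_upwards [hs.mem_nhds hqs] with x hx using hs0 x hx
      exact this.lineDeriv_eq.trans (by simp [lineDeriv])
    by_cases hqO : q ∈ openRect r l
    · have hgq : g =ᶠ[𝓝 q] fun x => x 0 * ψ x := by
        filter_upwards [(isOpen_openRect r l).mem_nhds hqO] with x hx
        have : χ x = 1 := cutoff_eq_one (by
          linarith [norm_le_of_mem_closedRect (openRect_subset_closedRect r l hx)])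
        simp only [g, this, one_mul, max_eq_left hx.1.le]
      have hpr : HasFDerivAt (fun x : Plane => x 0) (EuclideanSpace.proj 0 : Plane →L[ℝ] ℝ) q :=
        (EuclideanSpace.proj 0 : Plane →L[ℝ] ℝ).hasFDerivAt
      have hprod := (hpr.mul hq.hasFDerivAt).hasLineDerivAt (-e)
      rw [indicator_of_mem hqO, hgq.lineDeriv_eq]
      refine (congrArg (· * ψ q) hprod.lineDeriv).trans ?_
      rw [hq0 hqO]
      simp [e]
      ring
    · rw [indicator_of_notMem hqO]
      rcases hqc.resolve_left hqO with h | h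
      · rw [aux _ isOpen_leftHalf hgl0 h, zero_mul]
      · rw [aux _ (isOpen_outerRegion r l) hgo h, zero_mul]
  rw [hL, integral_congr_ae hR, integral_indicator (isOpen_openRect r l).measurableSet,
    integral_neg, eq_comm, neg_eq_zero] at h1
  have hint : IntegrableOn (fun p => ψ p ^ 2) (openRect r l) :=
    ((hψ.continuous.pow 2).continuousOn.integrableOn_compact (isCompact_closedRect r l)).mono_set
      (openRect_subset_closedRect r l)
  have h2 := (integral_eq_zero_iff_of_nonneg (fun p => sq_nonneg (ψ p)) hint).1 h1
  have h3 := (ae_restrict_iff' (isOpen_openRect r l).measurableSet).1 h2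
  exact mem_of_isClosed_of_ae hr hl (P := {p | ψ p = 0})
    (isClosed_eq hψ.continuous continuous_const)
    (by filter_upwards [h3] with q hq hqO using pow_eq_zero_iff two_ne_zero |>.1 (hq hqO)) hp

/-! ### The equality case: consequences for the differential -/

theorem pairJacobian_comb_right {F : Plane → R3} {p : Plane} (hF : DifferentiableAt ℝ F p)
    (a b d : R3) (c s : ℝ) :
    pairJacobian F a (c • b + s • d) p = c * pairJacobian F a b p + s * pairJacobian F a d p := by
  simp only [pairJacobian_eq hF, inner_add_left, inner_smul_left, conj_trivial]
  ring

theorem pairJacobian_comb_left {F : Plane → R3} {p : Plane} (hF : DifferentiableAt ℝ F p)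
    (a b d : R3) (c s : ℝ) :
    pairJacobian F (c • a + s • d) b p = c * pairJacobian F a b p + s * pairJacobian F d b p := by
  simp only [pairJacobian_eq hF, inner_add_left, inner_smul_left, conj_trivial]
  ring

theorem norm_comb_eq_one {b d : R3} (hb : ‖b‖ = 1) (hd : ‖d‖ = 1) (hbd : inner ℝ b d = 0) {c s : ℝ}
    (hcs : c ^ 2 + s ^ 2 = 1) : ‖c • b + s • d‖ = 1 := by
  have : ‖c • b + s • d‖ ^ 2 = 1 := by
    rw [norm_add_sq_real, norm_smul, norm_smul, inner_smul_left, inner_smul_right, hbd, hb, hd]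
    simp only [Real.norm_eq_abs, mul_one, sq_abs, mul_zero, add_zero]
    exact hcs
  exact (pow_eq_one_iff_of_nonneg (norm_nonneg _) two_ne_zero).1 this

/-- If the area of the image is at most the integral of one Jacobian, then this Jacobian dominates
all others. -/
theorem ae_abs_pairJacobian_le {F : Plane → R3} (hF : IsLipschitz F) {A : Set Plane}
    (hA : MeasurableSet A) (hAf : volume A ≠ ⊤) (hinj : InjOn F A) {a b c d : R3} (ha : ‖a‖ = 1)
    (hb : ‖b‖ = 1) (hab : inner ℝ a b = 0) (hc : ‖c‖ = 1) (hd : ‖d‖ = 1) (hcd : inner ℝ c d = 0)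
    (hle : μHE[2] (F '' A) ≤ ENNReal.ofReal (∫ p in A, pairJacobian F a b p)) :
    ∀ᵐ p ∂volume.restrict A, |pairJacobian F c d p| ≤ pairJacobian F a b p := by
  have hi1 : IntegrableOn (pairJacobian F a b) A :=
    integrableOn_jacobian (hF.inner_left a) (hF.inner_left b) hAf
  have hi2 : IntegrableOn (pairJacobian F c d) A :=
    integrableOn_jacobian (hF.inner_left c) (hF.inner_left d) hAf
  set g : Plane → ℝ := fun p => max |pairJacobian F a b p| |pairJacobian F c d p|
  have hg : IntegrableOn g A := hi1.abs.sup hi2.abs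
  have hg0 : ∀ p, 0 ≤ g p := fun p => (abs_nonneg _).trans (le_max_left _ _)
  -- The area lies between the integral of the maximum and the integral of the first Jacobian, which
  -- forces the two to agree almost everywhere. Truncation by `ENNReal.ofReal` adds the alternative
  -- that the integral of `g` is nonpositive; then both integrals are zero.
  have h1 := (lintegral_max_abs_pairJacobian_le hF hA hinj ha hb hab hc hd hcd).trans hle
  rw [← ofReal_integral_eq_lintegral_ofReal hg (Eventually.of_forall hg0),
    ENNReal.ofReal_le_ofReal_iff'] at h1
  have hJg : ∀ p, |pairJacobian F a b p| ≤ g p := fun p => le_max_left _ _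
  have h2 : |∫ p in A, pairJacobian F a b p| ≤ ∫ p in A, g p :=
    abs_integral_le_integral_abs.trans (integral_mono hi1.abs hg hJg)
  have h3 : ∫ p in A, pairJacobian F a b p = ∫ p in A, g p := by
    have := abs_le.1 h2
    rcases h1 with h1 | h1 <;> linarith
  have h4 := (integral_eq_iff_of_ae_le hi1 hg
    (Eventually.of_forall fun p => (le_abs_self _).trans (hJg p))).1 h3
  filter_upwards [h4] with p hp
  rw [hp]
  exact le_max_right _ _

/-- First variation: the function `c * J + s * X` of the rotation is maximal at `(1, 0)`, and `X` is
its derivative there. Since null sets permit only countably many rotations, the rational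
parametrization of the circle is used at `q = ±1/(k+1)`, where the bound reads `|X| ≤ |q| J`. -/
theorem ae_eq_zero_of_rotation {α : Type*} [MeasurableSpace α] {μ : Measure α} {J X : α → ℝ}
    (h : ∀ c s : ℝ, c ^ 2 + s ^ 2 = 1 → ∀ᵐ p ∂μ, |c * J p + s * X p| ≤ J p) :
    ∀ᵐ p ∂μ, X p = 0 := by
  have hq : ∀ q : ℝ, ∀ᵐ p ∂μ, |(1 - q ^ 2) * J p + 2 * q * X p| ≤ (1 + q ^ 2) * J p := fun q => by
    have hpos : 0 < 1 + q ^ 2 := by positivity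
    filter_upwards [h ((1 - q ^ 2) / (1 + q ^ 2)) (2 * q / (1 + q ^ 2)) (by field_simp; ring)]
      with p hp
    have := mul_le_mul_of_nonneg_left hp hpos.le
    rw [← abs_of_pos hpos, ← abs_mul, abs_of_pos hpos] at this
    have e : (1 + q ^ 2) * ((1 - q ^ 2) / (1 + q ^ 2) * J p + 2 * q / (1 + q ^ 2) * X p) =
        (1 - q ^ 2) * J p + 2 * q * X p := by field_simp
    rwa [e] at this
  filter_upwards [ae_all_iff.2 fun k : ℕ => hq (1 / ((k : ℝ) + 1)),
    ae_all_iff.2 fun k : ℕ => hq (-(1 / ((k : ℝ) + 1)))] with p h1 h2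
  have h3 : ∀ k : ℕ, |X p| ≤ 1 / ((k : ℝ) + 1) * J p := fun k => by
    have hq0 : 0 < 1 / ((k : ℝ) + 1) := Nat.one_div_pos_of_nat
    have e1 := (abs_le.1 (h1 k)).2
    have e2 := (abs_le.1 (h2 k)).2
    set q := 1 / ((k : ℝ) + 1)
    refine abs_le.2 ⟨?_, ?_⟩
    · refine le_of_mul_le_mul_left (a := q) ?_ hq0
      nlinarith
    · refine le_of_mul_le_mul_left (a := q) ?_ hq0
      nlinarith
  have h4 : Tendsto (fun k : ℕ => 1 / ((k : ℝ) + 1) * J p) atTop (𝓝 (0 * J p)) :=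
    tendsto_one_div_add_atTop_nhds_zero_nat.mul_const _
  rw [zero_mul] at h4
  exact abs_nonpos_iff.1 (ge_of_tendsto' h4 h3)

theorem pairJacobian_pos_of_vanishing {F : Plane → R3} {p : Plane} (hF : DifferentiableAt ℝ F p)
    (hinj : ∀ x, fderiv ℝ F p x = 0 → x = 0) {a b d : R3}
    (hspan : ∀ y : R3, inner ℝ a y = 0 → inner ℝ b y = 0 → inner ℝ d y = 0 → y = 0)
    (h0 : 0 ≤ pairJacobian F a b p) (h1 : pairJacobian F a d p = 0)
    (h2 : pairJacobian F d b p = 0) :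
    0 < pairJacobian F a b p ∧ fderiv ℝ (fun q => inner ℝ d (F q)) p = 0 := by
  rw [pairJacobian_eq hF] at h0 h1 h2 ⊢
  set L := fderiv ℝ F p
  set e : Plane := EuclideanSpace.single 0 1
  set e' : Plane := EuclideanSpace.single 1 1
  have hker : ∀ x y : ℝ, (x * inner ℝ a (L e) + y * inner ℝ a (L e') = 0) →
      (x * inner ℝ b (L e) + y * inner ℝ b (L e') = 0) →
      (x * inner ℝ d (L e) + y * inner ℝ d (L e') = 0) → x = 0 ∧ y = 0 := fun x y ha hb hd => by
    have : x • e + y • e' = 0 := by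
      refine hinj _ (hspan _ ?_ ?_ ?_) <;>
      · rw [map_add, map_smul, map_smul, inner_add_right, inner_smul_right, inner_smul_right]
        assumption
    exact ⟨by simpa [e, e'] using congrArg (fun z : Plane => z 0) this,
      by simpa [e, e'] using congrArg (fun z : Plane => z 1) this⟩
  -- This tangent vector is in the kernel of `d ∘ L` by construction, and its images under `a ∘ L`
  -- and `b ∘ L` are, up to sign, the two vanishing minors. Injectivity of `L` makes its
  -- coefficients zero. The same device with `a` and `b` in place of `d` shows that the remaining
  -- minor is not zero.
  obtain ⟨hd', hd⟩ := hker (inner ℝ d (L e')) (-inner ℝ d (L e)) (by linarith) (by linarith)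
    (by ring)
  rw [neg_eq_zero] at hd
  refine ⟨lt_of_le_of_ne h0 fun h => ?_, ?_⟩
  · obtain ⟨k1, k2⟩ := hker (inner ℝ a (L e')) (-inner ℝ a (L e)) (by ring) (by linarith)
      (by rw [hd, hd']; ring)
    obtain ⟨k3, k4⟩ := hker (inner ℝ b (L e')) (-inner ℝ b (L e)) (by linarith) (by ring)
      (by rw [hd, hd']; ring)
    rw [neg_eq_zero] at k2 k4
    exact one_ne_zero (hker 1 0 (by rw [k2]; ring) (by rw [k4]; ring) (by rw [hd]; ring)).1
  · ext x
    rw [fderiv_inner_left hF]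
    have hx : x = x 0 • e + x 1 • e' := by
      ext j
      fin_cases j <;> simp [e, e']
    rw [hx, map_add, map_smul, map_smul, inner_add_right, inner_smul_right, inner_smul_right]
    change x 0 * inner ℝ d (L e) + x 1 * inner ℝ d (L e') = 0
    rw [hd, hd']
    ring

theorem eq_zero_of_fderiv_apply_eq_zero {E G : Type*} [NormedAddCommGroup E] [NormedSpace ℝ E]
    [NormedAddCommGroup G] [NormedSpace ℝ G] {F : E → G} {p : E} {s : Set E} {K : NNReal}
    (hF : DifferentiableAt ℝ F p) (hs : s ∈ 𝓝 p)
    (hK : ∀ x ∈ s, ∀ y ∈ s, ‖x - y‖ ≤ K * ‖F x - F y‖) {x : E} (hx : fderiv ℝ F p x = 0) :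
    x = 0 := by
  have h1 := (hF.hasFDerivAt.hasLineDerivAt x).tendsto_slope_zero_right
  rw [hx] at h1
  have hp : p ∈ s := mem_of_mem_nhds hs
  have h2 : ∀ᶠ t : ℝ in 𝓝[>] 0, ‖x‖ ≤ K * ‖t⁻¹ • (F (p + t • x) - F p)‖ := by
    have hc : Tendsto (fun t : ℝ => p + t • x) (𝓝[>] 0) (𝓝 p) := by
      have : Tendsto (fun t : ℝ => p + t • x) (𝓝 0) (𝓝 (p + (0 : ℝ) • x)) :=
        (by fun_prop : Continuous fun t : ℝ => p + t • x).tendsto 0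
      rw [zero_smul, add_zero] at this
      exact this.mono_left nhdsWithin_le_nhds
    filter_upwards [hc.eventually hs, self_mem_nhdsWithin] with t ht ht0
    have ht0 : 0 < t := ht0
    have := hK _ ht p hp
    rw [add_sub_cancel_left, norm_smul, Real.norm_eq_abs, abs_of_pos ht0] at this
    rw [norm_smul, norm_inv, Real.norm_eq_abs, abs_of_pos ht0]
    calc ‖x‖ = t⁻¹ * (t * ‖x‖) := by field_simp
      _ ≤ t⁻¹ * (K * ‖F (p + t • x) - F p‖) := by gcongr
      _ = _ := by ring
  have h3 := ge_of_tendsto ((h1.norm).const_mul (K : ℝ)) h2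
  simpa using h3

theorem ofReal_integral_pairJacobian_le {F : Plane → R3} (hF : IsLipschitz F) {A : Set Plane}
    (hA : MeasurableSet A) (hAf : volume A ≠ ⊤) (hinj : InjOn F A) {a b : R3} (ha : ‖a‖ = 1)
    (hb : ‖b‖ = 1) (hab : inner ℝ a b = 0) :
    ENNReal.ofReal (∫ p in A, pairJacobian F a b p) ≤ μHE[2] (F '' A) := by
  have hi : IntegrableOn (pairJacobian F a b) A :=
    integrableOn_jacobian (hF.inner_left a) (hF.inner_left b) hAf
  refine le_trans ?_ (lintegral_abs_pairJacobian_le hF hA hinj ha hb hab)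
  rw [← ofReal_integral_eq_lintegral_ofReal hi.abs (Eventually.of_forall fun _ => abs_nonneg _)]
  exact ENNReal.ofReal_le_ofReal (integral_mono hi hi.abs fun _ => le_abs_self _)

theorem IsStationaryDirections.inner_vertical {n : ℕ} {v : Fin n → R3}
    (hv : IsStationaryDirections v) (i : Fin n) : inner ℝ (v i) vertical = 0 := by
  rw [inner_vertical_right, hv.horizontal]

theorem card_mul_volume_le_sum {n : ℕ} {v : Fin n → R3} (hv : IsStationaryDirections v)
    {r l : ℝ} (hr : 0 < r) (hl : 0 < l) {f : R3 → R3} (hf : IsLipschitz f)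
    (hfix : ∀ p ∈ edgeSet v r l, f p = p) :
    n * volume (openRect r l) ≤ ∑ i, ENNReal.ofReal
      (∫ p in openRect r l, pairJacobian (pageImage f (v i) r l) (v i) vertical p) := by
  have h : (n : ENNReal) * volume (openRect r l) =
      ENNReal.ofReal (n * (volume (openRect r l)).toReal) := by
    rw [ENNReal.ofReal_mul (by positivity), ENNReal.ofReal_natCast,
      ENNReal.ofReal_toReal (volume_openRect_ne_top r l)]
  rw [h, ← sum_integral_pairJacobian hv hr hl hf hfix]
  exact Finset.le_sum_of_subadditive ENNReal.ofReal ENNReal.ofReal_zero.le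
    (fun _ _ => ENNReal.ofReal_add_le) _ _

theorem euclideanHausdorffMeasure_book_le_image {n : ℕ} {v : Fin n → R3}
    (hv : IsStationaryDirections v) {r l : ℝ} (hr : 0 < r) (hl : 0 < l) {f : R3 → R3}
    (hf : IsLipschitz f) (hfi : f.Injective) (hfix : ∀ p ∈ edgeSet v r l, f p = p) :
    μHE[2] (book v r l) ≤ μHE[2] (f '' book v r l) := by
  refine (euclideanHausdorffMeasure_book_le hv l hr).trans
    ((card_mul_volume_le_sum hv hr hl hf hfix).trans ((Finset.sum_le_sum fun i _ => ?_).trans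
    (sum_euclideanHausdorffMeasure_pageImage_le hv l hr hf hfi)))
  exact ofReal_integral_pairJacobian_le (isLipschitz_pageImage hf _ r l)
    (isOpen_openRect r l).measurableSet (volume_openRect_ne_top r l)
    (injOn_pageImage hfi (hv.norm_eq_one i) (hv.horizontal i) r l) (hv.norm_eq_one i) norm_vertical
    (hv.inner_vertical i)

/-- The calibration inequality holds on every page; if the finite totals agree, no single page can
be strict. -/
theorem euclideanHausdorffMeasure_pageImage_le_of_eq {n : ℕ} {v : Fin n → R3}
    (hv : IsStationaryDirections v) {r l : ℝ} (hr : 0 < r) (hl : 0 < l) {f : R3 → R3}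
    (hf : IsLipschitz f) (hfi : f.Injective) (hfix : ∀ p ∈ edgeSet v r l, f p = p)
    (heq : μHE[2] (f '' book v r l) = μHE[2] (book v r l)) (i : Fin n) :
    μHE[2] (pageImage f (v i) r l '' openRect r l) ≤ ENNReal.ofReal
      (∫ p in openRect r l, pairJacobian (pageImage f (v i) r l) (v i) vertical p) := by
  set a : Fin n → ENNReal := fun i => ENNReal.ofReal
      (∫ p in openRect r l, pairJacobian (pageImage f (v i) r l) (v i) vertical p)
  set m : Fin n → ENNReal := fun i => μHE[2] (pageImage f (v i) r l '' openRect r l)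
  have ham : ∀ i, a i ≤ m i := fun i =>
    ofReal_integral_pairJacobian_le (isLipschitz_pageImage hf _ r l)
    (isOpen_openRect r l).measurableSet (volume_openRect_ne_top r l)
    (injOn_pageImage hfi (hv.norm_eq_one i) (hv.horizontal i) r l) (hv.norm_eq_one i) norm_vertical
    (hv.inner_vertical i)
  have hma : ∑ i, m i ≤ ∑ i, a i :=
    (sum_euclideanHausdorffMeasure_pageImage_le hv l hr hf hfi).trans
      (heq.le.trans ((euclideanHausdorffMeasure_book_le hv l hr).trans
      (card_mul_volume_le_sum hv hr hl hf hfix)))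
  rw [← Finset.add_sum_erase _ _ (Finset.mem_univ i),
    ← Finset.add_sum_erase _ a (Finset.mem_univ i)] at hma
  have hfin : ∑ j ∈ Finset.univ.erase i, a j ≠ ⊤ :=
    ENNReal.sum_ne_top.2 fun _ _ => ENNReal.ofReal_ne_top
  refine (ENNReal.add_le_add_iff_right hfin).1 (le_trans ?_ hma)
  gcongr with j
  exact ham j

/-! ### The equality case: image pages stay in their planes -/

/-- The unit normal of the half-plane with horizontal direction `u`. -/
noncomputable def pageNormal (u : R3) : R3 := !₂[-u 1, u 0, 0]

theorem inner_pageNormal (u x : R3) : inner ℝ (pageNormal u) x = -u 1 * x 0 + u 0 * x 1 := by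
  rw [inner_eq_sum]
  simp [pageNormal]

theorem norm_pageNormal {u : R3} (hu : ‖u‖ = 1) (hu2 : u 2 = 0) : ‖pageNormal u‖ = 1 := by
  have h : inner ℝ (pageNormal u) (pageNormal u) = (1 : ℝ) := by
    rw [inner_pageNormal]
    simp only [pageNormal, Matrix.cons_val_zero, Matrix.cons_val_one]
    linear_combination sq_add_sq_of_horizontal hu hu2
  rw [real_inner_self_eq_norm_sq] at h
  exact (pow_eq_one_iff_of_nonneg (norm_nonneg _) two_ne_zero).1 h

theorem inner_self_pageNormal (u : R3) : inner ℝ u (pageNormal u) = 0 := by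
  rw [real_inner_comm, inner_pageNormal]
  ring

theorem inner_vertical_pageNormal (u : R3) : inner ℝ vertical (pageNormal u) = 0 := by
  rw [inner_vertical_left]
  simp [pageNormal]

/-- A point orthogonal to the normal lies in the plane of the page. -/
theorem eq_comb_of_inner_pageNormal {u : R3} (hu : ‖u‖ = 1) (hu2 : u 2 = 0) {x : R3}
    (hx : inner ℝ (pageNormal u) x = 0) : x = inner ℝ u x • u + x 2 • vertical := by
  have h := sq_add_sq_of_horizontal hu hu2
  rw [inner_pageNormal] at hx
  ext j
  rw [inner_eq_sum, hu2]
  fin_cases j <;> simp [hu2]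
  · linear_combination (-x 0) * h - u 1 * hx
  · linear_combination (-x 1) * h + u 0 * hx

theorem eq_zero_of_inner_eq_zero {u : R3} (hu : ‖u‖ = 1) (hu2 : u 2 = 0) {x : R3}
    (h1 : inner ℝ u x = 0) (h2 : inner ℝ vertical x = 0) (h3 : inner ℝ (pageNormal u) x = 0) :
    x = 0 := by
  rw [eq_comb_of_inner_pageNormal hu hu2 h3, h1, ← inner_vertical_left x, h2, zero_smul, zero_smul,
    add_zero]

theorem ae_jacobian_pos_of_eq {n : ℕ} {v : Fin n → R3}
    (hv : IsStationaryDirections v) {r l : ℝ} (hr : 0 < r) (hl : 0 < l) {f : R3 → R3}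
    (hf : IsLipschitz f) {K : NNReal} (hK : AntilipschitzWith K f)
    (hfix : ∀ p ∈ edgeSet v r l, f p = p)
    (heq : μHE[2] (f '' book v r l) = μHE[2] (book v r l)) (i : Fin n) :
    ∀ᵐ p, p ∈ openRect r l → 0 < pairJacobian (pageImage f (v i) r l) (v i) vertical p ∧
      fderiv ℝ (fun q => inner ℝ (pageNormal (v i)) (pageImage f (v i) r l q)) p = 0 := by
  have hu := hv.norm_eq_one i
  have hu2 := hv.horizontal i
  set F := pageImage f (v i) r l
  set d := pageNormal (v i)
  have hF : IsLipschitz F := isLipschitz_pageImage hf _ r l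
  have hO := (isOpen_openRect r l).measurableSet
  have hdom : ∀ a b : R3, ‖a‖ = 1 → ‖b‖ = 1 → inner ℝ a b = 0 →
      ∀ᵐ p ∂volume.restrict (openRect r l), |pairJacobian F a b p| ≤
        pairJacobian F (v i) vertical p := fun a b ha hb hab =>
    ae_abs_pairJacobian_le hF hO (volume_openRect_ne_top r l)
      (injOn_pageImage hK.injective hu hu2 r l) hu norm_vertical (hv.inner_vertical i) ha hb hab
      (euclideanHausdorffMeasure_pageImage_le_of_eq hv hr hl hf hK.injective hfix heq i)
  have hdiff : ∀ᵐ p ∂volume.restrict (openRect r l), DifferentiableAt ℝ F p :=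
    ae_restrict_of_ae hF.ae_differentiableAt
  -- Here the second vector of the pair is rotated towards the normal; for `h2` it is the first one.
  have h1 : ∀ᵐ p ∂volume.restrict (openRect r l), pairJacobian F (v i) d p = 0 := by
    refine ae_eq_zero_of_rotation (J := pairJacobian F (v i) vertical) fun c s hcs => ?_
    filter_upwards [hdiff, hdom (v i) (c • vertical + s • d) hu
      (norm_comb_eq_one norm_vertical (norm_pageNormal hu hu2) (inner_vertical_pageNormal _) hcs)
      (by rw [inner_add_right, inner_smul_right, inner_smul_right, hv.inner_vertical,
            inner_self_pageNormal]; ring)] with p hp h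
    rwa [pairJacobian_comb_right hp] at h
  have h2 : ∀ᵐ p ∂volume.restrict (openRect r l), pairJacobian F d vertical p = 0 := by
    refine ae_eq_zero_of_rotation (J := pairJacobian F (v i) vertical) fun c s hcs => ?_
    filter_upwards [hdiff, hdom (c • v i + s • d) vertical
      (norm_comb_eq_one hu (norm_pageNormal hu hu2) (inner_self_pageNormal _) hcs) norm_vertical
      (by rw [inner_add_left, inner_smul_left, inner_smul_left, hv.inner_vertical,
            real_inner_comm, inner_vertical_pageNormal]; simp)] with p hp h
    rwa [pairJacobian_comb_left hp] at h
  rw [← ae_restrict_iff' hO]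
  filter_upwards [hdiff, h1, h2, hdom _ _ hu norm_vertical (hv.inner_vertical i),
    ae_restrict_mem hO] with p hp h1 h2 h0 hpO
  refine pairJacobian_pos_of_vanishing hp (fun x hx => ?_)
    (fun y => eq_zero_of_inner_eq_zero hu hu2) ((abs_nonneg _).trans h0) h1 h2
  refine eq_zero_of_fderiv_apply_eq_zero (K := K) hp ((isOpen_openRect r l).mem_nhds hpO)
    (fun y hy z hz => ?_) hx
  have := hK.le_mul_dist (pageMap (v i) y) (pageMap (v i) z)
  rwa [(isometry_pageMap hu hu2).dist_eq, dist_eq_norm, dist_eq_norm,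
    ← pageImage_of_mem (f := f) (u := v i) (openRect_subset_closedRect r l hy),
    ← pageImage_of_mem (f := f) (u := v i) (openRect_subset_closedRect r l hz)] at this

/-- The fixed edges lie in the plane of the page, so the normal component vanishes beyond the sides;
its derivative is zero almost everywhere inside. -/
theorem inner_pageNormal_pageImage_eq_zero {n : ℕ} {v : Fin n → R3}
    (hv : IsStationaryDirections v) {r l : ℝ} (hr : 0 < r) (hl : 0 < l) {f : R3 → R3}
    (hf : IsLipschitz f) {K : NNReal} (hK : AntilipschitzWith K f)
    (hfix : ∀ p ∈ edgeSet v r l, f p = p)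
    (heq : μHE[2] (f '' book v r l) = μHE[2] (book v r l)) (i : Fin n) {p : Plane}
    (hp : p ∈ closedRect r l) :
    inner ℝ (pageNormal (v i)) (pageImage f (v i) r l p) = 0 := by
  refine eq_zero_of_fderiv_eq_zero hr hl ((isLipschitz_pageImage hf _ r l).inner_left _)
    (fun q hq => ?_) ?_ hp
  · rw [pageImage, hfix _ (clampedPage_mem_edgeSet hv hr hl i hq), clampedPage, inner_add_right,
      inner_smul_right, inner_smul_right, real_inner_comm, inner_self_pageNormal,
      real_inner_comm, inner_vertical_pageNormal]
    ring
  · filter_upwards [ae_jacobian_pos_of_eq hv hr hl hf hK hfix heq i] with q hq hqO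
    exact (hq hqO).2

/-! ### The equality case: image pages stay in the book -/

/-- The signed distance by which `a` lies outside the interval `[lo, hi]`. -/
noncomputable def excess (lo hi a : ℝ) : ℝ := max (a - hi) 0 + min (a - lo) 0

theorem isLipschitz_excess (lo hi : ℝ) : IsLipschitz (excess lo hi) :=
  ((IsLipschitz.id.sub (IsLipschitz.const hi)).max (IsLipschitz.const 0)).add
    ((IsLipschitz.id.sub (IsLipschitz.const lo)).min (IsLipschitz.const 0))

theorem excess_of_mem {lo hi a : ℝ} (h : a ∈ Icc lo hi) : excess lo hi a = 0 := by
  rw [excess, max_eq_right (by linarith [h.2]), min_eq_right (by linarith [h.1]), add_zero]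

theorem excess_neg (r a : ℝ) : excess (-r) r (-a) = -excess (-r) r a := by
  simp only [excess]
  grind

/-- Near a point with value in the interval at most one of the two ends can be crossed, so the
excess has one sign there and a local extremum with value zero. This holds at every such point,
including those where `φ` is not differentiable. -/
theorem fderiv_excess_of_mem {lo hi : ℝ} (hlt : lo < hi) {φ : Plane → ℝ} (hφ : Continuous φ)
    {p : Plane} (hp : φ p ∈ Icc lo hi) : fderiv ℝ (fun q => excess lo hi (φ q)) p = 0 := by
  rcases lt_or_ge (φ p) hi with h | h
  · refine IsLocalMax.fderiv_eq_zero ?_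
    filter_upwards [hφ.continuousAt.eventually (gt_mem_nhds h)] with q hq
    rw [excess_of_mem hp, excess, max_eq_right (by linarith), zero_add]
    exact min_le_right _ _
  · refine IsLocalMin.fderiv_eq_zero ?_
    filter_upwards [hφ.continuousAt.eventually (lt_mem_nhds (hlt.trans_le h))] with q hq
    rw [excess_of_mem hp, excess, min_eq_right (by linarith), add_zero]
    exact le_max_right _ _

theorem fderiv_excess_of_notMem {lo hi : ℝ} (hlt : lo < hi) {φ : Plane → ℝ} (hφ : Continuous φ)
    {p : Plane} (hp : φ p ∉ Icc lo hi) :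
    fderiv ℝ (fun q => excess lo hi (φ q)) p = fderiv ℝ φ p := by
  rcases lt_or_ge (φ p) lo with h | h
  · have : (fun q => excess lo hi (φ q)) =ᶠ[𝓝 p] fun q => φ q - lo := by
      filter_upwards [hφ.continuousAt.eventually (gt_mem_nhds h)] with q hq
      rw [excess, max_eq_right (by linarith), min_eq_left (by linarith), zero_add]
    rw [this.fderiv_eq, fderiv_sub_const]
  · have h' : hi < φ p := by
      by_contra! h'
      exact hp ⟨h, h'⟩
    have : (fun q => excess lo hi (φ q)) =ᶠ[𝓝 p] fun q => φ q - hi := by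
      filter_upwards [hφ.continuousAt.eventually (lt_mem_nhds h')] with q hq
      rw [excess, max_eq_left (by linarith), min_eq_right (by linarith), add_zero]
    rw [this.fderiv_eq, fderiv_sub_const]

/-- Nonnegative integrands with zero total vanish almost everywhere on each page, which contradicts
positivity off `P i` unless the complement of `P i` is null in the rectangle. -/
theorem mem_of_sum_integral_jacobian_eq_zero {n : ℕ} {r l : ℝ} (hr : 0 < r) (hl : 0 < l)
    {U W : Fin n → Plane → ℝ} (hU : ∀ i, IsLipschitz (U i)) (hW : ∀ i, IsLipschitz (W i))
    (hsum : ∑ i, ∫ p in openRect r l, jacobian (U i) (W i) p = 0) {P : Fin n → Set Plane}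
    (hP : ∀ i, IsClosed (P i)) (hzero : ∀ i, ∀ p ∈ P i, jacobian (U i) (W i) p = 0)
    (hpos : ∀ i, ∀ᵐ p, p ∈ openRect r l → p ∉ P i → 0 < jacobian (U i) (W i) p) (i : Fin n)
    {p : Plane} (hp : p ∈ closedRect r l) : p ∈ P i := by
  have hO := (isOpen_openRect r l).measurableSet
  have hnn : ∀ i, 0 ≤ᵐ[volume.restrict (openRect r l)] jacobian (U i) (W i) := fun i => by
    refine (ae_restrict_iff' hO).2 ?_
    filter_upwards [hpos i] with q hq hqO
    by_cases hqP : q ∈ P i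
    · exact (hzero i q hqP).ge
    · exact (hq hqO hqP).le
  have h1 := (Finset.sum_eq_zero_iff_of_nonneg fun i _ => integral_nonneg_of_ae (hnn i)).1 hsum i
    (Finset.mem_univ i)
  have h2 := (ae_restrict_iff' hO).1 ((integral_eq_zero_iff_of_nonneg_ae (hnn i)
    (integrableOn_jacobian (hU i) (hW i) (volume_openRect_ne_top r l))).1 h1)
  refine mem_of_isClosed_of_ae hr hl (hP i) ?_ hp
  filter_upwards [h2, hpos i] with q hq hq' hqO
  by_contra hqP
  exact (hq' hqO hqP).ne' (hq hqO)

theorem jacobian_congr_fderiv {u u' w w' : Plane → ℝ} {p : Plane}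
    (hu : fderiv ℝ u p = fderiv ℝ u' p) (hw : fderiv ℝ w p = fderiv ℝ w' p) :
    jacobian u w p = jacobian u' w' p := by
  rw [jacobian, jacobian, hu, hw]

/-- At a point that lies in all planes of a stationary book, whose coordinates along the directions
are then equal up to sign, the excesses of these coordinates cancel. -/
theorem sum_excess_eq_zero {n : ℕ} {v : Fin n → R3} (hv : IsStationaryDirections v) (r : ℝ) {x : R3}
    (hr : 0 < r) (hx : ∀ i, inner ℝ (pageNormal (v i)) x = 0) :
    ∑ i, excess (-r) r (inner ℝ (v i) x) = 0 := by
  set ρ := √(x 0 ^ 2 + x 1 ^ 2)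
  have hρ : ρ ^ 2 = x 0 ^ 2 + x 1 ^ 2 := Real.sq_sqrt (by positivity)
  have hi : ∀ i, inner ℝ (v i) x = ρ ∨ inner ℝ (v i) x = -ρ := fun i => by
    have h := sq_add_sq_of_horizontal (hv.norm_eq_one i) (hv.horizontal i)
    have hxi := hx i
    rw [inner_pageNormal] at hxi
    rw [← sq_eq_sq_iff_eq_or_eq_neg, hρ, inner_eq_sum, hv.horizontal]
    linear_combination (x 0 ^ 2 + x 1 ^ 2) * h -
      (-v i 1 * x 0 + v i 0 * x 1) * hxi
  have h0 : excess (-r) r 0 = 0 := excess_of_mem ⟨by linarith, hr.le⟩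
  -- The excess over the symmetric interval is odd, so at `±ρ` it is proportional to the coordinate
  -- with a factor that does not depend on `i`. The sum is then a multiple of `⟪∑ i, v i, x⟫ = 0`.
  have hmul : ∀ i, ρ * excess (-r) r (inner ℝ (v i) x) = excess (-r) r ρ * inner ℝ (v i) x :=
    fun i => by
      rcases hi i with h | h <;> rw [h]
      · ring
      · rw [excess_neg]; ring
  by_cases h : ρ = 0
  · refine Finset.sum_eq_zero fun i _ => ?_
    rcases hi i with h' | h' <;> simp [h', h, h0]
  · refine (mul_eq_zero.1 ?_).resolve_left h
    rw [Finset.mul_sum, Finset.sum_congr rfl fun i _ => hmul i, ← Finset.mul_sum, ← sum_inner,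
      hv.sum_eq_zero, inner_zero_left, mul_zero]

/-- A point off the axis that lies in all the planes forces every direction to be `v j` or `-v j`.
Without `-v j` the sum of the directions would be `n • v j`, which is not zero. -/
theorem inner_eq_zero_of_forall_ne_neg {n : ℕ} {v : Fin n → R3} (hv : IsStationaryDirections v)
    {x : R3} (hx : ∀ i, inner ℝ (pageNormal (v i)) x = 0) {j : Fin n} (hj : ∀ i, v i ≠ -v j) :
    inner ℝ (v j) x = 0 := by
  by_contra hne
  have hcomb := fun i => eq_comb_of_inner_pageNormal (hv.norm_eq_one i) (hv.horizontal i) (hx i)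
  have heq : ∀ i, v i = v j := fun i => by
    have h : inner ℝ (v i) x • v i = inner ℝ (v j) x • v j :=
      add_right_cancel ((hcomb i).symm.trans (hcomb j))
    have h2 := congrArg norm h
    rw [norm_smul, norm_smul, hv.norm_eq_one, hv.norm_eq_one, mul_one, mul_one, Real.norm_eq_abs,
      Real.norm_eq_abs] at h2
    rcases abs_eq_abs.1 h2 with h3 | h3
    · rw [h3] at h
      exact smul_right_injective R3 hne h
    · rw [h3, neg_smul, ← smul_neg] at h
      have := smul_right_injective R3 hne h
      exact (hj i (by rw [← this, neg_neg])).elim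
  have h1 := congrArg (inner ℝ (v j)) hv.sum_eq_zero
  rw [inner_sum, Finset.sum_congr rfl fun i _ => by rw [heq i], inner_zero_right] at h1
  simp only [real_inner_self_eq_norm_sq, hv.norm_eq_one, Finset.sum_const, Finset.card_univ,
    Fintype.card_fin, one_pow, nsmul_eq_mul, mul_one, Nat.cast_eq_zero] at h1
  exact (h1 ▸ j).elim0

theorem image_book_subset_of_eq {n : ℕ} {v : Fin n → R3}
    (hv : IsStationaryDirections v) {r l : ℝ} (hr : 0 < r) (hl : 0 < l) {f : R3 → R3}
    (hf : IsLipschitz f) {K : NNReal} (hK : AntilipschitzWith K f)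
    (hfix : ∀ p ∈ edgeSet v r l, f p = p)
    (heq : μHE[2] (f '' book v r l) = μHE[2] (book v r l)) :
    f '' book v r l ⊆ book v r l := by
  set F : Fin n → Plane → R3 := fun i => pageImage f (v i) r l
  have hF : ∀ i, IsLipschitz (F i) := fun i => isLipschitz_pageImage hf _ r l
  set U : Fin n → Plane → ℝ := fun i p => inner ℝ (v i) (F i p)
  set W : Fin n → Plane → ℝ := fun i p => inner ℝ vertical (F i p)
  have hU : ∀ i, IsLipschitz (U i) := fun i => (hF i).inner_left _
  have hW : ∀ i, IsLipschitz (W i) := fun i => (hF i).inner_left _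
  have hnormal : ∀ i, ∀ p ∈ closedRect r l, inner ℝ (pageNormal (v i)) (F i p) = 0 := fun i p hp =>
    inner_pageNormal_pageImage_eq_zero hv hr hl hf hK hfix heq i hp
  have hjac := fun i => ae_jacobian_pos_of_eq hv hr hl hf hK hfix heq i
  -- The spine belongs to every page, so its image lies in all the planes at once.
  have hspine : ∀ (s : ℝ) (i : Fin n),
      inner ℝ (pageNormal (v i)) (f (max 0 (min s l) • vertical)) = 0 := fun s i => by
    have hq : (!₂[0, max 0 (min s l)] : Plane) ∈ closedRect r l := by
      simp [closedRect, hr.le, hl.le]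
    have := hnormal i _ hq
    simp only [F] at this
    rw [pageImage_of_mem hq] at this
    simpa [pageMap] using this
  have hUout : ∀ i, ∀ p ∈ outerRegion r l, U i p ∈ Icc 0 r := fun i p hp => by
    simp only [U, F, pageImage, hfix _ (clampedPage_mem_edgeSet hv hr hl i hp),
      inner_clampedPage (hv.norm_eq_one i) (hv.horizontal i)]
    exact ⟨le_max_left _ _, max_le hr.le (min_le_right _ _)⟩
  have hWout : ∀ i, ∀ p ∈ outerRegion r l, W i p ∈ Icc 0 l := fun i p hp => by
    simp only [W, F, pageImage, hfix _ (clampedPage_mem_edgeSet hv hr hl i hp),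
      inner_vertical_clampedPage (hv.horizontal i)]
    exact ⟨le_max_left _ _, max_le hl.le (min_le_right _ _)⟩
  -- Stokes for `dU ∧ d(excess W)`: the excess vanishes on the fixed sides, and at the spine the `U
  -- i` add up to zero. Where `W i` leaves `[0, l]` the integrand is the positive calibrating
  -- Jacobian.
  have hWmem : ∀ i, ∀ p ∈ closedRect r l, W i p ∈ Icc 0 l := by
    intro i p hp
    refine mem_of_sum_integral_jacobian_eq_zero hr hl (U := U) (W := fun i p => excess 0 l (W i p))
      (P := fun i => {p | W i p ∈ Icc 0 l}) hU (fun i => (isLipschitz_excess 0 l).comp (hW i)) ?_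
      (fun i => isClosed_Icc.preimage (hW i).continuous) ?_ ?_ i hp
    · refine sum_integral_jacobian_eq_zero
        (w := fun p => excess 0 l (inner ℝ vertical (f (max 0 (min (p 1) l) • vertical))))
        hU (fun i => (isLipschitz_excess 0 l).comp (hW i)) (fun p hp => ?_) (fun i p hp => ?_)
        fun i => Or.inr fun p hp => excess_of_mem (hWout i p hp)
      · simp only [U, F, pageImage_of_neg hp]
        rw [← sum_inner, hv.sum_eq_zero, inner_zero_left]
      · simp only [W, F, pageImage_of_neg hp]
    · exact fun i p hp =>
        jacobian_eq_zero_of_fderiv_right (fderiv_excess_of_mem hl (hW i).continuous hp)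
    · intro i
      filter_upwards [hjac i] with p hp hpO hpP
      rw [jacobian_congr_fderiv rfl (fderiv_excess_of_notMem hl (hW i).continuous hpP)]
      exact (hp hpO).1
  -- Now the excess is taken of `U i`, and the cancellation at the spine is `sum_excess_eq_zero`;
  -- this requires the interval `[-r, r]` rather than `[0, r]`.
  have hUmem : ∀ i, ∀ p ∈ closedRect r l, U i p ∈ Icc (-r) r := by
    intro i p hp
    refine mem_of_sum_integral_jacobian_eq_zero hr hl (U := fun i p => excess (-r) r (U i p))
      (W := W) (P := fun i => {p | U i p ∈ Icc (-r) r})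
      (fun i => (isLipschitz_excess _ _).comp (hU i)) hW ?_
      (fun i => isClosed_Icc.preimage (hU i).continuous) ?_ ?_ i hp
    · refine sum_integral_jacobian_eq_zero
        (w := fun p => inner ℝ vertical (f (max 0 (min (p 1) l) • vertical)))
        (fun i => (isLipschitz_excess _ _).comp (hU i)) hW (fun p hp => ?_) (fun i p hp => ?_)
        fun i => Or.inl fun p hp => excess_of_mem
          ⟨(neg_nonpos.2 hr.le).trans (hUout i p hp).1, (hUout i p hp).2⟩
      · simp only [U, F, pageImage_of_neg hp]
        exact sum_excess_eq_zero hv r hr (hspine (p 1))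
      · simp only [W, F, pageImage_of_neg hp]
    · exact fun i p hp => jacobian_eq_zero_of_fderiv_left
        (fderiv_excess_of_mem (by linarith) (hU i).continuous hp)
    · intro i
      filter_upwards [hjac i] with p hp hpO hpP
      rw [jacobian_congr_fderiv (fderiv_excess_of_notMem (by linarith) (hU i).continuous hpP) rfl]
      exact (hp hpO).1
  -- If `-v j` is not a direction, then `U j` is zero on the spine, so the Stokes formula applies to
  -- this page alone (`n = 1`) and with the interval `[0, r]`.
  have hUnonneg : ∀ j, (∀ i, v i ≠ -v j) → ∀ p ∈ closedRect r l, U j p ∈ Icc 0 r := by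
    intro j hj p hp
    refine mem_of_sum_integral_jacobian_eq_zero (n := 1) hr hl
      (U := fun _ p => excess 0 r (U j p)) (W := fun _ => W j) (P := fun _ => {p | U j p ∈ Icc 0 r})
      (fun _ => (isLipschitz_excess _ _).comp (hU j)) (fun _ => hW j) ?_
      (fun _ => isClosed_Icc.preimage (hU j).continuous) ?_ ?_ 0 hp
    · refine sum_integral_jacobian_eq_zero (w := W j)
        (fun _ => (isLipschitz_excess _ _).comp (hU j)) (fun _ => hW j) (fun p hp => ?_)
        (fun _ p hp => rfl) fun _ => Or.inl fun p hp => excess_of_mem (hUout j p hp)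
      · simp only [U, F, pageImage_of_neg hp]
        rw [inner_eq_zero_of_forall_ne_neg hv (hspine (p 1)) hj, excess_of_mem ⟨le_rfl, hr.le⟩,
          Finset.sum_const_zero]
    · exact fun _ p hp => jacobian_eq_zero_of_fderiv_left
        (fderiv_excess_of_mem hr (hU j).continuous hp)
    · intro _
      filter_upwards [hjac j] with p hp hpO hpP
      rw [jacobian_congr_fderiv (fderiv_excess_of_notMem hr (hU j).continuous hpP) rfl]
      exact (hp hpO).1
  rintro _ ⟨x, hx, rfl⟩
  rw [book_eq_iUnion hv l hr] at hx ⊢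
  obtain ⟨j, p, hp, rfl⟩ := mem_iUnion.1 hx
  have hcomb := eq_comb_of_inner_pageNormal (hv.norm_eq_one j) (hv.horizontal j) (hnormal j p hp)
  rw [← inner_vertical_left] at hcomb
  have hW1 := hWmem j p hp
  have hU1 := hUmem j p hp
  have hFp : F j p = f (pageMap (v j) p) := pageImage_of_mem hp
  rw [← hFp]
  by_cases h0 : 0 ≤ U j p
  · refine mem_iUnion.2 ⟨j, !₂[U j p, W j p], ⟨h0, hU1.2, hW1.1, hW1.2⟩, ?_⟩
    rw [hcomb]
    simp [pageMap, U, W]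
  -- A negative coordinate is possible only if the opposite half-plane also belongs to the book, and
  -- then the point lies on that page.
  · obtain ⟨i, hi⟩ : ∃ i, v i = -v j := by
      by_contra! hj
      exact h0 (hUnonneg j hj p hp).1
    refine mem_iUnion.2 ⟨i, !₂[-U j p, W j p], ⟨?_, ?_, hW1.1, hW1.2⟩, ?_⟩
    · simpa using (not_le.1 h0).le
    · simpa using neg_le.1 hU1.1
    · rw [hcomb]
      simp [pageMap, U, W, hi]

/-! ### Equality of the sets -/

theorem isCompact_book {n : ℕ} {v : Fin n → R3} (hv : IsStationaryDirections v) {r : ℝ} (l : ℝ)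
    (hr : 0 < r) : IsCompact (book v r l) := by
  rw [book_eq_iUnion hv l hr]
  exact isCompact_iUnion fun i => (isCompact_closedRect r l).image
    (isometry_pageMap (hv.norm_eq_one i) (hv.horizontal i)).continuous

/-- Every relatively open piece of a page has positive area, so a closed set that misses only a null
part of the book misses nothing. -/
theorem book_subset_of_measure_diff_eq_zero {n : ℕ} {v : Fin n → R3}
    (hv : IsStationaryDirections v) {r l : ℝ} (hr : 0 < r) (hl : 0 < l) {s : Set R3}
    (hs : IsClosed s) (h : μHE[2] (book v r l \ s) = 0) : book v r l ⊆ s := by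
  rw [book_eq_iUnion hv l hr] at h ⊢
  refine iUnion_subset fun i => ?_
  rintro _ ⟨p, hp, rfl⟩
  have hiso := isometry_pageMap (hv.norm_eq_one i) (hv.horizontal i)
  refine mem_of_isClosed_of_ae hr hl (P := pageMap (v i) ⁻¹' s) (hs.preimage hiso.continuous) ?_ hp
  rw [ae_iff, ← euclideanHausdorffMeasure_pageMap_image (hv.norm_eq_one i) (hv.horizontal i)]
  refine measure_mono_null ?_ h
  rintro _ ⟨q, hq, rfl⟩
  obtain ⟨hqO, hqs⟩ := Classical.not_imp.1 hq
  exact ⟨mem_iUnion.2 ⟨i, q, openRect_subset_closedRect r l hqO, rfl⟩, hqs⟩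

theorem mainTheorem5 {n : ℕ} (v : Fin n → R3) (hv : IsStationaryDirections v)
    (r l : ℝ) (hr : 0 < r) (hl : 0 < l)
    (f : R3 → R3) (hf : IsBilipschitz f) (hfix : ∀ p ∈ edgeSet v r l, f p = p) :
    μHE[2] (book v r l) ≤ μHE[2] (f '' book v r l) ∧
      (μHE[2] (f '' book v r l) = μHE[2] (book v r l) → f '' book v r l = book v r l) := by
  obtain ⟨hfl, K, hK⟩ := hf
  refine ⟨euclideanHausdorffMeasure_book_le_image hv hr hl hfl hK.injective hfix, fun heq => ?_⟩
  have hsub := image_book_subset_of_eq hv hr hl hfl hK hfix heq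
  have hcpt : IsCompact (f '' book v r l) :=
    (isCompact_book hv l hr).image (IsLipschitz.continuous hfl)
  refine hsub.antisymm (book_subset_of_measure_diff_eq_zero hv hr hl hcpt.isClosed ?_)
  have hfin : μHE[2] (f '' book v r l) ≠ ⊤ := by
    rw [heq]
    exact ne_top_of_le_ne_top (ENNReal.mul_ne_top (ENNReal.natCast_ne_top n)
      (volume_openRect_ne_top r l)) (euclideanHausdorffMeasure_book_le hv l hr)
  rw [measure_sdiff hsub hcpt.isClosed.measurableSet.nullMeasurableSet hfin, heq, tsub_self]
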